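/- All spaces are real Banach spaces and all vector fields are $C^\infty$. For a vector field $f$ on $Y$ and a rooted tree $\tau=[\tau_1,\dots,\tau_k]$ let $F(\tau)(y)=f^{(k)}(y)\bigl(F(\tau_1)(y),\dots,F(\tau_k)(y)\bigr)$ be its elementary differential. The B-series method with coefficients $a(\tau)\in\mathbb R$ ($\tau$ ranging over all rooted trees) is the formal integrator $$\Phi_{hf}(y)=y+\sum_{\tau}\frac{h^{|\tau|}}{\sigma(\tau)}\,a(\tau)\,F(\tau)(y)\in Y[[h]],$$ where $|\tau|$ is the number of vertices and $\sigma(\tau)$ the number of automorphisms of $\tau$. For a smooth map $G$ on $Y$, $G\circ\Phi_{hf}$ denotes the formal power series in $h$ obtained by Taylor expansion. Given a class $\mathcal F$ of smooth maps between Banach spaces, $\Phi$ is *$\mathcal F$-functionally equivariant* if for all $Y,Z$, all $F\in\mathcal F(Y,Z)$ and all vector fields $f$ on $Y$, $$(\mathrm{id},F)\circ\Phi_{hf}=\Phi_{hg}\circ(\mathrm{id},F),\qquad g(y,z)=\bigl(f(y),F'(y)f(y)\bigr)\ \text{ on } Y\times Z;$$ and $\Phi$ *preserves $\mathcal F$-invariants*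 if $F\circ\Phi_{hf}=F$ whenever $F\in\mathcal F(Y,Z)$ and $F'(y)f(y)=0$ for all $y\in Y$. Affine, quadratic and cubic maps are the continuous polynomial maps of degree at most $1$, $2$ and $3$. (a) Every B-series method is affine functionally equivariant. (b) Every B-series method that preserves quadratic invariants is quadratic functionally equivariant. For example, for every $s$ the $s$-stage Gauss–Legendre collocation method preserves quadratic invariants and is quadratic functionally equivariant, both as a B-series and as an actual Runge–Kutta method, in the following sense (step size $1$). If $F\in\mathcal F(Y,Z)$ is quadratic and is an invariant of $f$, then every step $y_0\mapsto y_1$ for $f$ satisfies $F(y_1)=F(y_0)$. If $F$ is quadratic and $f$ is arbitrary, then the steps for $g$ from $(y_0,F(y_0))$ are exactly those to $(y_1,F(y_1))$ with $y_0\mapsto y_1$ a step for $f$. (c) No B-series method is cubic functionally equivariant, other than the exact flow up to a constant rescaling of time. That is, if a B-series method $\Phi$ is such that for no constant $r\in\mathbb R$ the series $Y(h)=\Phi_{hf}(y)$ is, for all $Y$, $f$ and $y$, the formal solution of $dY/dh=r f(Y)$, $Y(0)=y$, then $\Phi$ is not cubic functionally equivariant. -/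

import Mathlib

open scoped ContDiff Nat

universe u

noncomputable section

/-! ### Rooted trees -/

/-- Plane rooted trees: a root with an ordered tuple of `k` subtrees. -/
inductive PlaneTree : Type
  | node (k : ℕ) (child : Fin k → PlaneTree) : PlaneTree

namespace PlaneTree

/-- The number of vertices. -/
def order : PlaneTree → ℕ
  | node _ child => 1 + ∑ i, (child i).order

/-- The product of `k_v !` over all vertices `v`, where `k_v` is the number of children of `v`. -/
def branchFactorial : PlaneTree → ℕ
  | node k child => k ! * ∏ i, (child i).branchFactorial

/-- Elementary reorderings: permute the subtrees at the root, or reorder inside one subtree. -/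
inductive Reorder : PlaneTree → PlaneTree → Prop
  | perm (k : ℕ) (child : Fin k → PlaneTree) (e : Equiv.Perm (Fin k)) :
      Reorder (node k child) (node k (child ∘ e))
  | sub (k : ℕ) (child : Fin k → PlaneTree) (i : Fin k) (t : PlaneTree) :
      Reorder (child i) t → Reorder (node k child) (node k (Function.update child i t))

theorem finite_order_eq (n : ℕ) : {t : PlaneTree | t.order = n}.Finite := by
  induction n using Nat.strong_induction_on with
  | _ n ih =>
    have h1 : {t : PlaneTree | t.order < n}.Finite := by
      have : {t : PlaneTree | t.order < n} = ⋃ m ∈ Set.Iio n, {t : PlaneTree | t.order = m} := by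
        ext t; simp
      rw [this]
      exact (Set.finite_Iio n).biUnion fun m hm => ih m hm
    have h2 : (⋃ k ∈ Set.Iio n, (fun c : Fin k → PlaneTree => node k c) ''
        (Set.univ.pi fun _ => {t : PlaneTree | t.order < n})).Finite :=
      (Set.finite_Iio n).biUnion fun k _ => (Set.Finite.pi' fun _ => h1).image _ |>.subset (by
        apply Set.image_mono
        intro c hc i
        exact hc i trivial)
    refine h2.subset ?_
    rintro ⟨k, c⟩ ht
    have ht' : 1 + ∑ i, (c i).order = n := ht
    have hpos : ∀ t : PlaneTree, 1 ≤ t.order := by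
      rintro ⟨k, c⟩; exact Nat.le_add_right 1 _
    have hk : k ≤ ∑ i, (c i).order := by
      calc k = ∑ _i : Fin k, 1 := by simp
        _ ≤ _ := Finset.sum_le_sum fun i _ => hpos (c i)
    simp only [Set.mem_iUnion]
    refine ⟨k, ?_, c, ?_, rfl⟩
    · simp only [Set.mem_Iio]; omega
    · intro i _
      have : (c i).order ≤ ∑ i, (c i).order :=
        Finset.single_le_sum (f := fun i => (c i).order) (fun _ _ => Nat.zero_le _)
          (Finset.mem_univ i)
      simp only [Set.mem_ofPred_eq]; omega

/-- The plane trees with `n` vertices. -/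
def ofOrder (n : ℕ) : Finset PlaneTree := (finite_order_eq n).toFinset

/-- The elementary differential of a vector field `f` attached to a tree:
`D^k f (y) (F(t₁)(y), …, F(t_k)(y))` for the tree with subtrees `t₁, …, t_k`. -/
def elementaryDifferential {Y : Type u} [NormedAddCommGroup Y] [NormedSpace ℝ Y] (f : Y → Y) :
    PlaneTree → Y → Y
  | node k child => fun y =>
      iteratedFDeriv ℝ k f y fun i => elementaryDifferential f (child i) y

end PlaneTree

/-- (Non-plane) rooted trees: plane trees up to reordering of subtrees. -/
def ButcherTree : Type := Quot PlaneTree.Reorder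

/-- The rooted tree underlying a plane tree. -/
def PlaneTree.toRooted (t : PlaneTree) : ButcherTree := Quot.mk _ t

/-! ### Formal numerical integrators and B-series -/

/-- A one-step method as a formal series in the step size `h`: the vector field `f` on `Y` and
the initial value `y` are sent to the sequence of coefficients of `Φ_{hf}(y) ∈ Y⟦h⟧`. -/
abbrev FormalIntegrator : Type (u + 1) :=
  ∀ (Y : Type u) [NormedAddCommGroup Y] [NormedSpace ℝ Y], (Y → Y) → Y → ℕ → Y

/-- The B-series method with coefficients `a`,
`Φ_{hf}(y) = y + ∑_τ h^{|τ|} a(τ)/σ(τ) F(τ)(y)`, the sum being over all rooted trees `τ`, with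
`σ(τ)` the number of automorphisms of `τ`.
The sum is written over plane trees `t`: a rooted tree `τ` has `(∏_v k_v !)/σ(τ)` plane
representatives, and for smooth `f` all of them have the elementary differential `F(τ)`. -/
def bSeries (a : ButcherTree → ℝ) : FormalIntegrator.{u} := fun _ _ _ f y n =>
  if n = 0 then y else
    ∑ t ∈ PlaneTree.ofOrder n,
      (a t.toRooted / t.branchFactorial) • t.elementaryDifferential f y

/-- Substitution of a formal series `∑ hⁿ cₙ` in a map `F` smooth near `c₀`: the sequence of
coefficients of `F (∑ hⁿ cₙ)`. The `n`-th one is the `n`-th Taylor coefficient at `h = 0` of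
`h ↦ F (c₀ + h c₁ + ⋯ + hⁿ cₙ)` (later `cᵢ` do not influence it). -/
def formalComp {Y Z : Type u} [NormedAddCommGroup Y] [NormedSpace ℝ Y] [NormedAddCommGroup Z]
    [NormedSpace ℝ Z] (F : Y → Z) (c : ℕ → Y) (n : ℕ) : Z :=
  (n ! : ℝ)⁻¹ • iteratedDeriv n (fun h : ℝ => F (∑ i ∈ Finset.range (n + 1), h ^ i • c i)) 0

/-! ### Functional equivariance and invariants -/

/-- A class of maps `𝓕(Y, Z)` between normed spaces. -/
abbrev MapClass : Type (u + 1) :=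
  ∀ (Y Z : Type u) [NormedAddCommGroup Y] [NormedSpace ℝ Y] [NormedAddCommGroup Z]
    [NormedSpace ℝ Z], (Y → Z) → Prop

/-- Continuous affine maps. -/
def affineMaps : MapClass.{u} := fun Y Z _ _ _ _ F => ∃ A : Y →ᴬ[ℝ] Z, ∀ y, F y = A y

/-- Continuous polynomial maps of degree at most `d`. -/
def polynomialMaps (d : ℕ) : MapClass.{u} := fun Y Z _ _ _ _ F =>
  ∃ p : (k : ℕ) → ContinuousMultilinearMap ℝ (fun _ : Fin k => Y) Z,
    ∀ y, F y = ∑ k ∈ Finset.range (d + 1), p k fun _ => y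

/-- Quadratic maps. -/
def quadraticMaps : MapClass.{u} := polynomialMaps 2

/-- Cubic maps. -/
def cubicMaps : MapClass.{u} := polynomialMaps 3

/-- The augmented vector field `g(y, z) = (f(y), F'(y) f(y))`. -/
def augmentedField {Y Z : Type u} [NormedAddCommGroup Y] [NormedSpace ℝ Y]
    [NormedAddCommGroup Z] [NormedSpace ℝ Z] (F : Y → Z) (f : Y → Y) : Y × Z → Y × Z :=
  fun p => (f p.1, fderiv ℝ F p.1 (f p.1))

/-- `Φ` is `𝓕`-functionally equivariant: `(id, F) ∘ Φ_f = Φ_g ∘ (id, F)`, with `g` the augmented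
vector field, for all `F ∈ 𝓕(Y, Z)`, all smooth vector fields `f` on `Y` and all Banach spaces
`Y`, `Z`. -/
def FunctionallyEquivariant (𝓕 : MapClass.{u}) (Φ : FormalIntegrator.{u}) : Prop :=
  ∀ (Y Z : Type u) [NormedAddCommGroup Y] [NormedSpace ℝ Y] [CompleteSpace Y]
    [NormedAddCommGroup Z] [NormedSpace ℝ Z] [CompleteSpace Z] (F : Y → Z), 𝓕 Y Z F →
    ∀ f : Y → Y, ContDiff ℝ ∞ f → ∀ y : Y,
      formalComp (fun x => (x, F x)) (Φ Y f y) = Φ (Y × Z) (augmentedField F f) (y, F y)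

/-- `F` is an invariant (first integral) of the vector field `f`. -/
def IsFirstIntegral {Y Z : Type u} [NormedAddCommGroup Y] [NormedSpace ℝ Y]
    [NormedAddCommGroup Z] [NormedSpace ℝ Z] (F : Y → Z) (f : Y → Y) : Prop :=
  ∀ y, fderiv ℝ F y (f y) = 0

/-- `Φ` preserves `𝓕`-invariants: `F ∘ Φ_f = F` whenever `F ∈ 𝓕(Y, Z)` is an invariant of `f`
(on the right, `F y` is the constant formal series). -/
def PreservesInvariants (𝓕 : MapClass.{u}) (Φ : FormalIntegrator.{u}) : Prop :=
  ∀ (Y Z : Type u) [NormedAddCommGroup Y] [NormedSpace ℝ Y] [CompleteSpace Y]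
    [NormedAddCommGroup Z] [NormedSpace ℝ Z] [CompleteSpace Z] (F : Y → Z), 𝓕 Y Z F →
    ∀ f : Y → Y, ContDiff ℝ ∞ f → IsFirstIntegral F f → ∀ y : Y,
      formalComp F (Φ Y f y) = fun n => if n = 0 then F y else 0

/-- `Φ` is the exact flow with time rescaled by `r`: the series `Y(h) = Φ_{hf}(y)` is the formal
solution of `dY/dh = r f(Y)`, `Y(0) = y`. -/
def IsExactFlow (r : ℝ) (Φ : FormalIntegrator.{u}) : Prop :=
  ∀ (Y : Type u) [NormedAddCommGroup Y] [NormedSpace ℝ Y] [CompleteSpace Y]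
    (f : Y → Y), ContDiff ℝ ∞ f → ∀ y : Y,
      Φ Y f y 0 = y ∧
      ∀ n : ℕ, ((n : ℝ) + 1) • Φ Y f y (n + 1) = r • formalComp f (Φ Y f y) n

/-! ### Runge–Kutta methods and Gauss–Legendre collocation -/

/-- The weight of a tree at stage `i`: `φᵢ(t) = ∏ₘ ∑ⱼ aᵢⱼ φⱼ(tₘ)` over the subtrees `tₘ`. -/
def PlaneTree.stageWeight {s : ℕ} (A : Fin s → Fin s → ℝ) : PlaneTree → Fin s → ℝ
  | .node _ child => fun i => ∏ m, ∑ j, A i j * (child m).stageWeight A j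

theorem PlaneTree.stageWeight_reorder {s : ℕ} (A : Fin s → Fin s → ℝ) {t t' : PlaneTree}
    (h : PlaneTree.Reorder t t') : t.stageWeight A = t'.stageWeight A := by
  induction h with
  | perm k child e =>
    funext i
    exact (Equiv.prod_comp e fun m => ∑ j, A i j * (child m).stageWeight A j).symm
  | sub k child i t _ ih =>
    funext l
    simp only [PlaneTree.stageWeight]
    refine Finset.prod_congr rfl fun m _ => ?_
    by_cases hm : m = i
    · subst hm; simp [ih]
    · simp [Function.update_of_ne hm]

/-- The elementary weights `φ(τ) = ∑ᵢ bᵢ φᵢ(τ)`, the B-series coefficients of the Runge–Kutta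
method with tableau `(A, b)`. -/
def rkWeight {s : ℕ} (A : Fin s → Fin s → ℝ) (b : Fin s → ℝ) : ButcherTree → ℝ :=
  Quot.lift (fun t : PlaneTree => ∑ i, b i * t.stageWeight A i) fun _ _ h => by
    simp only [PlaneTree.stageWeight_reorder A h]

/-- `y₁` results from `y₀` by a Runge–Kutta step (unit step size) for the vector field `f`. -/
def RKStep {s : ℕ} (A : Fin s → Fin s → ℝ) (b : Fin s → ℝ) {Y : Type u} [NormedAddCommGroup Y]
    [NormedSpace ℝ Y] (f : Y → Y) (y₀ y₁ : Y) : Prop :=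
  ∃ S : Fin s → Y, (∀ i, S i = y₀ + ∑ j, A i j • f (S j)) ∧ y₁ = y₀ + ∑ i, b i • f (S i)

/-- `c` lists the `s` roots of the shifted Legendre polynomial of degree `s` on `[0, 1]`. -/
def IsGaussNodes {s : ℕ} (c : Fin s → ℝ) : Prop :=
  Function.Injective c ∧ ∀ i, Polynomial.aeval (c i) (Polynomial.shiftedLegendre s) = 0

/-- The matrix `aᵢⱼ = ∫₀^{cᵢ} ℓⱼ` of the collocation method with nodes `c`, where `ℓⱼ` are the
Lagrange basis polynomials. -/
def collocationMatrix {s : ℕ} (c : Fin s → ℝ) (i j : Fin s) : ℝ :=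
  ∫ x in (0 : ℝ)..c i, (Lagrange.basis Finset.univ c j).eval x

/-- The weights `bⱼ = ∫₀¹ ℓⱼ` of the collocation method with nodes `c`. -/
def collocationWeights {s : ℕ} (c : Fin s → ℝ) (j : Fin s) : ℝ :=
  ∫ x in (0 : ℝ)..1, (Lagrange.basis Finset.univ c j).eval x

end

/-!
Along `Φ = bSeries a` a smooth map `G` expands as the sum, over the trees `τ = [τ₁, …, τₖ]` and with
the weights `h^(|τ| - 1) / σ(τ)`, of `a(τ₁) ⋯ a(τₖ) G^(k)(F(τ₁), …, F(τₖ))`. The second component of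
the method for the augmented field of a map `F` is the series with coefficients `a` attached in the
same way to the map `F'f`, and equivariance with respect to `F` equates it with `F ∘ Φ`.

* For affine `F` both series are `F'` applied to `Φ`.
* The map `z - F(y)` is an invariant of the augmented field and polynomial of the same degree as
  `F`, so preserving such invariants forces equivariance.
* The collocation method at the Gauss nodes satisfies `bᵢ aᵢⱼ + bⱼ aⱼᵢ = bᵢ bⱼ`, because its
  quadrature integrates `ℓᵢ ∫ ℓⱼ` exactly; expanding a quadratic `F` then gives
  `F(y₁) - F(y₀) = ∑ᵢ bᵢ F'(Sᵢ) f(Sᵢ)` for the stages `Sᵢ`.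
* On a space with one coordinate per rooted tree there is a vector field all of whose coordinates
  separate elementary differentials. Cubic equivariance for products of three coordinates yields
  `a(s₁) ⋯ a(sₖ) = ∑ᵢ a(sᵢ with all sⱼ, j ≠ i, attached to its root)` for `k ≤ 3`, and grafting
  trees together extends this to all `k`. An induction on trees turns it into the recursion
  `|τ| a(τ) = a(•) a(τ₁) ⋯ a(τₖ)` of the exact flow in time rescaled by `a(•)`.
-/

noncomputable section

section Jets

open Asymptotics Filter Topology

variable {E F : Type*} [NormedAddCommGroup E] [NormedSpace ℝ E]
  [NormedAddCommGroup F] [NormedSpace ℝ F]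

/-- `u h = ∑_{i ≤ n} hⁱ dᵢ + o(hⁿ)` as `h → 0`: the expansion of `u` to order `n` at `0`, by which
formal power series in the step size are compared with smooth functions of it. -/
def HasJet (n : ℕ) (u : ℝ → E) (d : ℕ → E) : Prop :=
  (fun h : ℝ => u h - ∑ i ∈ Finset.range (n + 1), h ^ i • d i) =o[𝓝 0] fun h : ℝ => h ^ n

theorem eq_zero_of_pow_smul_isLittleO {n : ℕ} {c : E}
    (h : (fun x : ℝ => x ^ n • c) =o[𝓝 0] fun x : ℝ => x ^ n) : c = 0 := by
  by_contra hc
  have hO : (fun x : ℝ => x ^ n) =O[𝓝 0] fun x : ℝ => x ^ n • c :=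
    IsBigO.of_bound ‖c‖⁻¹ <| Eventually.of_forall fun x => by
      rw [norm_smul, mul_comm, mul_inv_cancel_right₀ (norm_ne_zero_iff.2 hc)]
  have hne : ∀ᶠ x : ℝ in 𝓝[≠] 0, ‖x ^ n‖ ≠ 0 := by
    filter_upwards [self_mem_nhdsWithin] with x hx using norm_ne_zero_iff.2 (pow_ne_zero n hx)
  exact isLittleO_irrefl' (hne.frequently.filter_mono nhdsWithin_le_nhds) (hO.trans_isLittleO h)

theorem pow_smul_isLittleO {m n : ℕ} (hmn : n < m) (c : E) :
    (fun x : ℝ => x ^ m • c) =o[𝓝 0] fun x : ℝ => x ^ n :=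
  (IsBigO.of_bound ‖c‖ <| Eventually.of_forall fun x => by
    rw [norm_smul, mul_comm]).trans_isLittleO (isLittleO_pow_pow hmn)

namespace HasJet

variable {n : ℕ} {u : ℝ → E} {d e : ℕ → E}

theorem of_succ (h : HasJet (n + 1) u d) : HasJet n u d := by
  refine ((h.trans (isLittleO_pow_pow n.lt_succ_self)).add
    (pow_smul_isLittleO n.lt_succ_self (d (n + 1)))).congr_left fun x => ?_
  rw [Finset.sum_range_succ _ (n + 1)]
  abel

theorem unique (hd : HasJet n u d) (he : HasJet n u e) : ∀ i ≤ n, d i = e i := by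
  induction n with
  | zero =>
    intro i hi
    obtain rfl : i = 0 := by omega
    refine sub_eq_zero.1 (eq_zero_of_pow_smul_isLittleO (n := 0) ?_)
    simpa [smul_sub] using IsLittleO.sub he hd
  | succ n ih =>
    have hlow := ih hd.of_succ he.of_succ
    intro i hi
    obtain hi | rfl : i ≤ n ∨ i = n + 1 := by omega
    · exact hlow i hi
    · refine sub_eq_zero.1 (eq_zero_of_pow_smul_isLittleO (n := n + 1) ?_)
      refine (IsLittleO.sub he hd).congr_left fun x => ?_
      have hsum : ∑ i ∈ Finset.range (n + 1), x ^ i • d i =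
          ∑ i ∈ Finset.range (n + 1), x ^ i • e i :=
        Finset.sum_congr rfl fun i hi => by rw [hlow i (Finset.mem_range_succ_iff.1 hi)]
      rw [Finset.sum_range_succ _ (n + 1), Finset.sum_range_succ _ (n + 1), hsum, smul_sub]
      abel

end HasJet

theorem hasJet_iteratedDeriv {n : ℕ} {u : ℝ → E} (hu : ContDiff ℝ n u) :
    HasJet n u fun i => (i ! : ℝ)⁻¹ • iteratedDeriv i u 0 := by
  have h := taylor_isLittleO_univ (x₀ := 0) hu
  simp only [sub_zero] at h
  refine h.congr_left fun x => ?_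
  rw [taylor_within_apply]
  congr 1
  refine Finset.sum_congr rfl fun i _ => ?_
  rw [iteratedDerivWithin_univ, smul_smul, sub_zero, mul_comm]

theorem norm_inv_factorial_smul_integral_le {g : ℝ → F} {C : ℝ} (hg : ∀ t ∈ Set.Ioc 0 1, ‖g t‖ ≤ C)
    (n : ℕ) : ‖(n ! : ℝ)⁻¹ • ∫ t in (0 : ℝ)..1, (1 - t) ^ n • g t‖ ≤ C := by
  have hint : ‖∫ t in (0 : ℝ)..1, (1 - t) ^ n • g t‖ ≤ C * |1 - 0| := by
    refine intervalIntegral.norm_integral_le_of_norm_le_const fun t ht => ?_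
    rw [Set.uIoc_of_le zero_le_one] at ht
    have hweight : ‖(1 - t) ^ n‖ ≤ 1 := by
      rw [norm_pow]
      refine pow_le_one₀ (norm_nonneg _) (abs_le.2 ?_)
      constructor <;> linarith [ht.1, ht.2]
    rw [norm_smul]
    exact (mul_le_of_le_one_left (norm_nonneg _) hweight).trans (hg t ht)
  have hfac : ‖(n ! : ℝ)⁻¹‖ ≤ 1 := by
    rw [norm_inv, Real.norm_natCast]
    exact inv_le_one_of_one_le₀ (by exact_mod_cast n.factorial_pos)
  rw [norm_smul]
  calc _ ≤ 1 * (C * |1 - 0|) := by gcongr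
    _ = C := by simp

theorem taylor_remainder_isBigO [CompleteSpace F] {G : E → F} {N : ℕ}
    (hG : ContDiff ℝ (N + 1) G) (y : E) :
    (fun v : E => G (y + v) - ∑ k ∈ Finset.range (N + 1),
      (k ! : ℝ)⁻¹ • iteratedFDeriv ℝ k G y fun _ => v) =O[𝓝 0] fun v => ‖v‖ ^ (N + 1) := by
  have hcont : ContinuousAt (iteratedFDeriv ℝ (N + 1) G) y :=
    (hG.continuous_iteratedFDeriv le_rfl).continuousAt
  obtain ⟨ε, hε, hball⟩ :=
    Metric.eventually_nhds_iff_ball.1 (hcont.norm.eventually_lt_const (lt_add_one _))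
  refine IsBigO.of_bound (‖iteratedFDeriv ℝ (N + 1) G y‖ + 1) ?_
  filter_upwards [Metric.ball_mem_nhds (0 : E) hε] with v hv
  rw [map_add_eq_sum_add_integral_iteratedFDeriv (n := N) fun t _ => hG.contDiffAt,
    add_sub_cancel_left, norm_pow, norm_norm]
  refine norm_inv_factorial_smul_integral_le (fun t ht => ?_) N
  have hmem : y + t • v ∈ Metric.ball y ε := by
    rw [mem_ball_iff_norm, add_sub_cancel_left, norm_smul, Real.norm_of_nonneg ht.1.le]
    exact (mul_le_of_le_one_left (norm_nonneg v) ht.2).trans_lt (mem_ball_zero_iff.1 hv)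
  have hop := (iteratedFDeriv ℝ (N + 1) G (y + t • v)).le_opNorm fun _ => v
  rw [Finset.prod_const, Finset.card_fin] at hop
  exact hop.trans (by gcongr; exact (hball _ hmem).le)

end Jets

section FormalComp

variable {Y Z W : Type u} [NormedAddCommGroup Y] [NormedSpace ℝ Y]
  [NormedAddCommGroup Z] [NormedSpace ℝ Z] [NormedAddCommGroup W] [NormedSpace ℝ W]

theorem formalComp_eq_of_hasJet {G : Y → Z} {c : ℕ → Y} {d : ℕ → Z} {n : ℕ} (hG : ContDiff ℝ n G)
    (h : HasJet n (fun h : ℝ => G (∑ i ∈ Finset.range (n + 1), h ^ i • c i)) d) :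
    formalComp G c n = d n :=
  (hasJet_iteratedDeriv (hG.comp (by fun_prop))).unique h n le_rfl

theorem formalComp_id (c : ℕ → Y) (n : ℕ) : formalComp (fun x => x) c n = c n :=
  formalComp_eq_of_hasJet contDiff_fun_id (by simp [HasJet])

theorem formalComp_clm_comp {G : Y → Z} {n : ℕ} (hG : ContDiff ℝ n G) (L : Z →L[ℝ] W)
    (c : ℕ → Y) : formalComp (fun x => L (G x)) c n = L (formalComp G c n) := by
  have hcurve : ContDiff ℝ n fun h : ℝ => G (∑ i ∈ Finset.range (n + 1), h ^ i • c i) :=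
    hG.comp (by fun_prop)
  simp only [formalComp, iteratedDeriv_eq_iteratedFDeriv, map_smul]
  congr 1
  exact congrArg (fun M => M fun _ => 1) (L.iteratedFDeriv_comp_left hcurve.contDiffAt le_rfl)

theorem formalComp_const_add (G : Y → Z) (z : Z) (c : ℕ → Y) {n : ℕ} (hn : n ≠ 0) :
    formalComp (fun x => z + G x) c n = formalComp G c n := by
  simp only [formalComp, iteratedDeriv_const_add (Nat.pos_of_ne_zero hn)]

theorem formalComp_comp_fst (F : Y → Z) (c : ℕ → Y × W) (n : ℕ) :
    formalComp (fun p : Y × W => F p.1) c n = formalComp F (fun i => (c i).1) n := by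
  simp only [formalComp, Prod.fst_sum, Prod.smul_fst]

theorem formalComp_prodMk {F : Y → Z} {G : Y → W} {n : ℕ} (hF : ContDiff ℝ n F)
    (hG : ContDiff ℝ n G) (c : ℕ → Y) :
    formalComp (fun x => (F x, G x)) c n = (formalComp F c n, formalComp G c n) :=
  Prod.ext (formalComp_clm_comp (hF.prodMk hG) (.fst ℝ Z W) c).symm
    (formalComp_clm_comp (hF.prodMk hG) (.snd ℝ Z W) c).symm

theorem formalComp_snd_sub_comp_fst {F : Y → Z} {n : ℕ} (hF : ContDiff ℝ n F)
    (c : ℕ → Y × Z) :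
    formalComp (fun p : Y × Z => p.2 - F p.1) c n =
      (c n).2 - formalComp F (fun i => (c i).1) n := by
  have hF' : ContDiff ℝ n fun p : Y × Z => F p.1 := hF.comp contDiff_fst
  have hsnd : formalComp Prod.snd c n = (c n).2 :=
    (formalComp_clm_comp contDiff_fun_id (ContinuousLinearMap.snd ℝ Y Z) c).trans
      (congrArg Prod.snd (formalComp_id c n))
  refine (formalComp_clm_comp (contDiff_snd.prodMk hF')
    (ContinuousLinearMap.fst ℝ Z Z - ContinuousLinearMap.snd ℝ Z Z) c).trans ?_
  rw [formalComp_prodMk contDiff_snd hF', formalComp_comp_fst, hsnd]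
  rfl

end FormalComp

section RootedTrees

namespace PlaneTree

theorem mem_ofOrder {n : ℕ} {t : PlaneTree} : t ∈ ofOrder n ↔ t.order = n := by
  simp [ofOrder]

theorem order_pos (t : PlaneTree) : 0 < t.order := by
  cases t; simp only [order]; omega

theorem order_child_lt {k : ℕ} (c : Fin k → PlaneTree) (i : Fin k) :
    (c i).order < (node k c).order := by
  have : (c i).order ≤ ∑ i, (c i).order :=
    Finset.single_le_sum (f := fun i => (c i).order) (fun _ _ => Nat.zero_le _) (Finset.mem_univ i)
  simp only [order]; omega

theorem card_children_lt {k : ℕ} (c : Fin k → PlaneTree) : k < (node k c).order := by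
  have : k ≤ ∑ i, (c i).order :=
    calc k = ∑ _i : Fin k, 1 := by simp
      _ ≤ ∑ i, (c i).order := Finset.sum_le_sum fun i _ => (c i).order_pos
  simp only [order]; omega

theorem Reorder.order_eq {t t' : PlaneTree} (h : Reorder t t') : t.order = t'.order := by
  induction h with
  | perm k c e => simp only [order, Function.comp_apply, Equiv.sum_comp e fun i => (c i).order]
  | sub k c i t _ ih =>
    simp only [order, Function.apply_update fun _ => order, ← ih]
    simp only [Function.update_eq_self]

theorem toRooted_node_perm {k : ℕ} (c : Fin k → PlaneTree) (e : Equiv.Perm (Fin k)) :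
    (node k (c ∘ e)).toRooted = (node k c).toRooted :=
  (Quot.sound (Reorder.perm k c e)).symm

theorem toRooted_node_update {k : ℕ} (c : Fin k → PlaneTree) (i : Fin k) {t : PlaneTree}
    (h : t.toRooted = (c i).toRooted) :
    (node k (Function.update c i t)).toRooted = (node k c).toRooted := by
  let replace : ButcherTree → ButcherTree :=
    Quot.lift (fun s => (node k (Function.update c i s)).toRooted) fun s s' hs => by
      have := Reorder.sub k (Function.update c i s) i s' (by simpa using hs)
      rw [Function.update_idem] at this
      exact Quot.sound this
  have := congrArg replace h
  change (node k _).toRooted = (node k (Function.update c i (c i))).toRooted at this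
  rwa [Function.update_eq_self] at this

theorem toRooted_node_congr {k : ℕ} {c c' : Fin k → PlaneTree}
    (h : ∀ i, (c' i).toRooted = (c i).toRooted) :
    (node k c').toRooted = (node k c).toRooted := by
  have hpiece (s : Finset (Fin k)) :
      (node k (s.piecewise c' c)).toRooted = (node k c).toRooted := by
    induction s using Finset.induction_on with
    | empty => rw [Finset.piecewise_empty]
    | insert i s hi ih =>
      rw [Finset.piecewise_insert, toRooted_node_update, ih]
      rw [Finset.piecewise_eq_of_notMem _ _ _ hi, h i]
  simpa using hpiece Finset.univ

end PlaneTree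

theorem exists_equiv_of_map_univ_eq {ι κ α : Type*} [Fintype ι] [Fintype κ] {f : ι → α}
    {g : κ → α} (h : Finset.univ.val.map f = Finset.univ.val.map g) :
    ∃ e : ι ≃ κ, ∀ i, g (e i) = f i := by
  classical
  have hfiber (a : α) : Nonempty ({i // f i = a} ≃ {j // g j = a}) := by
    have hcount := congrArg (Multiset.count a) h
    rw [Multiset.count_map, Multiset.count_map] at hcount
    refine Fintype.card_eq.1 ?_
    rw [Fintype.card_subtype, Fintype.card_subtype]
    simpa only [eq_comm, Finset.card, Finset.filter_val] using hcount
  exact ⟨Equiv.ofFiberEquiv fun a => (hfiber a).some, Equiv.ofFiberEquiv_map _⟩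

open PlaneTree

namespace ButcherTree

instance : DecidableEq ButcherTree := Classical.decEq _

/-- The forest of subtrees at the root, as a multiset. -/
def children : ButcherTree → Multiset ButcherTree :=
  Quot.lift (fun | node _ c => Finset.univ.val.map fun i => (c i).toRooted) fun _ _ h => by
    cases h with
    | perm k c e =>
      have h := congrArg (Multiset.map fun i => (c i).toRooted) (Multiset.map_univ_val_equiv e)
      rw [Multiset.map_map] at h
      exact h.symm
    | sub k c i t h =>
      refine Multiset.map_congr rfl fun j _ => ?_
      obtain rfl | hj := eq_or_ne j i
      · rw [Function.update_self]
        exact Quot.sound h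
      · rw [Function.update_of_ne hj]

theorem children_toRooted_node {k : ℕ} (c : Fin k → PlaneTree) :
    (node k c).toRooted.children = Finset.univ.val.map fun i => (c i).toRooted := rfl

theorem children_injective : Function.Injective children := by
  rintro ⟨k, c⟩ ⟨k', c'⟩ (h : (node k c).toRooted.children = (node k' c').toRooted.children)
  rw [children_toRooted_node, children_toRooted_node] at h
  obtain rfl : k = k' := by simpa using congrArg Multiset.card h
  obtain ⟨e, he⟩ := exists_equiv_of_map_univ_eq h
  exact (toRooted_node_congr he).symm.trans (toRooted_node_perm c' e)

theorem children_surjective : Function.Surjective children := by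
  rintro ⟨l⟩
  choose rep hrep using Quot.exists_rep (r := Reorder)
  refine ⟨(node l.length fun i => rep (l.get i)).toRooted, ?_⟩
  have hget (i : Fin l.length) : (rep (l.get i)).toRooted = l.get i := hrep _
  simp only [children_toRooted_node, hget]
  rw [Fin.univ_val_map, List.ofFn_get]
  rfl

/-- The tree `[τ₁, …, τₖ]` whose root carries the subtrees of the forest `τ₁, …, τₖ`. -/
def join : Multiset ButcherTree → ButcherTree :=
  Function.surjInv children_surjective

theorem children_join (M : Multiset ButcherTree) : (join M).children = M :=
  Function.surjInv_eq children_surjective M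

theorem join_children (t : ButcherTree) : join t.children = t :=
  children_injective (children_join _)

/-- The tree with a single vertex. -/
def leaf : ButcherTree := join 0

/-- The tree obtained from `t` by attaching the trees of the forest `M` to its root; for a forest
with one tree this is the Butcher product. -/
def graft (t : ButcherTree) (M : Multiset ButcherTree) : ButcherTree := join (t.children + M)

theorem children_graft (t : ButcherTree) (M : Multiset ButcherTree) :
    (t.graft M).children = t.children + M := children_join _

theorem leaf_graft_children (t : ButcherTree) : leaf.graft t.children = t := by
  rw [graft, leaf, children_join, zero_add, join_children]

theorem graft_graft (t : ButcherTree) (M M' : Multiset ButcherTree) :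
    (t.graft M).graft M' = t.graft (M + M') := by
  rw [graft, children_graft, graft, add_assoc]

/-- The number of vertices. -/
def order : ButcherTree → ℕ := Quot.lift PlaneTree.order fun _ _ h => h.order_eq

theorem order_toRooted (t : PlaneTree) : t.toRooted.order = t.order := rfl

theorem order_eq (t : ButcherTree) : t.order = 1 + (t.children.map order).sum := by
  obtain ⟨k, c⟩ := t
  change (node k c).toRooted.order = 1 + ((node k c).toRooted.children.map order).sum
  rw [children_toRooted_node, Multiset.map_map]
  rfl

theorem order_lt_of_mem_children {s t : ButcherTree} (hs : s ∈ t.children) : s.order < t.order := by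
  have := Multiset.le_sum_of_mem (Multiset.mem_map_of_mem order hs)
  rw [order_eq t]
  omega

theorem order_graft (t : ButcherTree) (M : Multiset ButcherTree) :
    (t.graft M).order = t.order + (M.map order).sum := by
  rw [order_eq, children_graft, Multiset.map_add, Multiset.sum_add, order_eq t, add_assoc]

theorem order_pos (t : ButcherTree) : 0 < t.order := by
  rw [order_eq]; omega

theorem card_children_lt_order (t : ButcherTree) : t.children.card < t.order := by
  obtain ⟨k, c⟩ := t
  change (node k c).toRooted.children.card < (node k c).order
  rw [children_toRooted_node, Multiset.card_map, Finset.card_val, Finset.card_fin]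
  exact card_children_lt c

/-- The product `a(τ₁) ⋯ a(τₖ)` over the subtrees of `τ = [τ₁, …, τₖ]`. -/
def childProd (a : ButcherTree → ℝ) (t : ButcherTree) : ℝ := (t.children.map a).prod

theorem childProd_toRooted_node (a : ButcherTree → ℝ) {k : ℕ} (c : Fin k → PlaneTree) :
    childProd a (node k c).toRooted = ∏ i, a (c i).toRooted := by
  rw [childProd, children_toRooted_node, Multiset.map_map]
  rfl

theorem childProd_graft (a : ButcherTree → ℝ) (t : ButcherTree) (M : Multiset ButcherTree) :
    childProd a (t.graft M) = childProd a t * (M.map a).prod := by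
  rw [childProd, children_graft, Multiset.map_add, Multiset.prod_add, childProd]

theorem childProd_leaf (a : ButcherTree → ℝ) : childProd a leaf = 1 := by
  rw [childProd, leaf, children_join, Multiset.map_zero, Multiset.prod_zero]

theorem order_leaf : order leaf = 1 := by
  rw [order_eq, leaf, children_join, Multiset.map_zero, Multiset.sum_zero, add_zero]

end ButcherTree

end RootedTrees

section ElementaryDifferentials

open Asymptotics Filter Topology ButcherTree

namespace PlaneTree

section

variable {Y : Type u} {Z W : Type*} [NormedAddCommGroup Y] [NormedSpace ℝ Y]
  [NormedAddCommGroup Z] [NormedSpace ℝ Z] [NormedAddCommGroup W] [NormedSpace ℝ W]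

/-- The elementary differential with a map `G` in place of the vector field at the root:
`D^k G (y) (F(t₁)(y), …, F(t_k)(y))` for the tree with subtrees `t₁, …, t_k`. These are the
derivatives of `G` along series of elementary differentials of `f`. -/
def rootDifferential (f : Y → Y) (G : Y → Z) (y : Y) : PlaneTree → Z
  | node k c => iteratedFDeriv ℝ k G y fun i => (c i).elementaryDifferential f y

theorem elementaryDifferential_eq (f : Y → Y) (t : PlaneTree) (y : Y) :
    t.elementaryDifferential f y = rootDifferential f f y t := by
  cases t; rfl

theorem rootDifferential_clm_comp (f : Y → Y) {G : Y → Z} (hG : ContDiff ℝ ∞ G) (L : Z →L[ℝ] W)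
    (y : Y) (t : PlaneTree) :
    rootDifferential f (fun x => L (G x)) y t = L (rootDifferential f G y t) := by
  obtain ⟨k, c⟩ := t
  exact congrArg (fun M => M fun i => (c i).elementaryDifferential f y)
    (L.iteratedFDeriv_comp_left (contDiff_infty.1 hG k).contDiffAt le_rfl)

theorem rootDifferential_sum (f : Y → Y) {ι : Type*} {G : ι → Y → Z} {s : Finset ι}
    (hG : ∀ i ∈ s, ContDiff ℝ ∞ (G i)) (y : Y) (t : PlaneTree) :
    rootDifferential f (fun x => ∑ i ∈ s, G i x) y t = ∑ i ∈ s, rootDifferential f (G i) y t := by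
  obtain ⟨k, c⟩ := t
  simp only [rootDifferential]
  rw [iteratedFDeriv_fun_sum_apply fun i hi => (contDiff_infty.1 (hG i hi) k).contDiffAt,
    sum_apply]

variable {X : Type u} [NormedAddCommGroup X] [NormedSpace ℝ X]

theorem map_elementaryDifferential {f : X → X} {g : Y → Y} (hf : ContDiff ℝ ∞ f)
    (hg : ContDiff ℝ ∞ g) (P : X →L[ℝ] Y) (hP : ∀ x, P (f x) = g (P x)) (x : X) (t : PlaneTree) :
    P (t.elementaryDifferential f x) = t.elementaryDifferential g (P x) := by
  induction t with
  | node k c ih =>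
    rw [elementaryDifferential_eq, ← rootDifferential_clm_comp f hf, elementaryDifferential_eq]
    simp only [rootDifferential, hP]
    refine (congrArg (fun M => M fun i => (c i).elementaryDifferential f x)
      (P.iteratedFDeriv_comp_right (contDiff_infty.1 hg k) x le_rfl)).trans ?_
    simp [ih]

theorem rootDifferential_comp_clm {f : X → X} {g : Y → Y} (hf : ContDiff ℝ ∞ f)
    (hg : ContDiff ℝ ∞ g) (P : X →L[ℝ] Y) (hP : ∀ x, P (f x) = g (P x)) {G : Y → Z}
    (hG : ContDiff ℝ ∞ G) (x : X) (t : PlaneTree) :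
    rootDifferential f (fun x => G (P x)) x t = rootDifferential g G (P x) t := by
  obtain ⟨k, c⟩ := t
  refine (congrArg (fun M => M fun i => (c i).elementaryDifferential f x)
    (P.iteratedFDeriv_comp_right (contDiff_infty.1 hG k) x le_rfl)).trans ?_
  simp [rootDifferential, map_elementaryDifferential hf hg P hP]

end

/-- The plane trees with at most `N` vertices. -/
def ofOrderLE (N : ℕ) : Finset PlaneTree :=
  ((Set.finite_Iic N).biUnion fun n _ => finite_order_eq n).toFinset

theorem mem_ofOrderLE {N : ℕ} {t : PlaneTree} : t ∈ ofOrderLE N ↔ t.order ≤ N := by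
  simp [ofOrderLE]

theorem sum_range_sum_ofOrder_succ {M : Type*} [AddCommMonoid M] (g : PlaneTree → M) (N : ℕ) :
    ∑ n ∈ Finset.range N, ∑ t ∈ ofOrder (n + 1), g t = ∑ t ∈ ofOrderLE N, g t := by
  have hpos (t : PlaneTree) : 0 < t.order := t.order_pos
  rw [← Finset.sum_fiberwise_of_maps_to (s := ofOrderLE N) (t := Finset.range N)
    (g := fun t => t.order - 1)]
  · refine Finset.sum_congr rfl fun n hn => Finset.sum_congr ?_ fun _ _ => rfl
    ext t
    specialize hpos t
    rw [Finset.mem_range] at hn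
    rw [mem_ofOrder, Finset.mem_filter, mem_ofOrderLE]
    omega
  · intro t ht
    specialize hpos t
    rw [mem_ofOrderLE] at ht
    rw [Finset.mem_range]
    omega

/-- The plane trees with at most `N` subtrees at the root, each with at most `N` vertices: the
index set of the expanded Taylor polynomial of degree `N` along a series of order `N`. -/
def treesWithChildrenLE (N : ℕ) : Finset PlaneTree :=
  ((Finset.range (N + 1)).sigma fun k => Fintype.piFinset fun _ : Fin k => ofOrderLE N).map
    ⟨fun p => node p.1 p.2, by
      rintro ⟨k, c⟩ ⟨k', c'⟩ h
      exact Sigma.ext (node.inj h).1 (node.inj h).2⟩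

theorem sum_treesWithChildrenLE {M : Type*} [AddCommMonoid M] (g : PlaneTree → M) (N : ℕ) :
    ∑ t ∈ treesWithChildrenLE N, g t =
      ∑ k ∈ Finset.range (N + 1), ∑ c ∈ Fintype.piFinset fun _ : Fin k => ofOrderLE N,
        g (node k c) := by
  rw [treesWithChildrenLE, Finset.sum_map, Finset.sum_sigma]
  rfl

theorem ofOrderLE_succ_subset (N : ℕ) : ofOrderLE (N + 1) ⊆ treesWithChildrenLE N := by
  rintro ⟨k, c⟩ ht
  rw [mem_ofOrderLE] at ht
  have hk := card_children_lt c
  have hc := order_child_lt c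
  simp only [treesWithChildrenLE, Finset.mem_map, Finset.mem_sigma, Finset.mem_range,
    Fintype.mem_piFinset, mem_ofOrderLE]
  exact ⟨⟨k, c⟩, ⟨by lia, fun i => by have := hc i; lia⟩, rfl⟩

end PlaneTree

open PlaneTree

variable {Y : Type u} {Z W : Type*} [NormedAddCommGroup Y] [NormedSpace ℝ Y]
  [NormedAddCommGroup Z] [NormedSpace ℝ Z] [NormedAddCommGroup W] [NormedSpace ℝ W]

/-- The coefficients of the series `∑_τ h^{|τ|} b(τ)/σ(τ) F_G(τ)(y)`, where `F_G(τ)` is the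
elementary differential of `τ` with `G` in place of `f` at the root. It is summed over plane trees,
normalized as in `bSeries`. -/
def rootSeries (b : ButcherTree → ℝ) (f : Y → Y) (G : Y → Z) (y : Y) (n : ℕ) : Z :=
  ∑ t ∈ ofOrder n, (b t.toRooted / t.branchFactorial) • rootDifferential f G y t

theorem rootSeries_clm_comp (b : ButcherTree → ℝ) (f : Y → Y) {G : Y → Z} (hG : ContDiff ℝ ∞ G)
    (L : Z →L[ℝ] W) (y : Y) (n : ℕ) :
    rootSeries b f (fun x => L (G x)) y n = L (rootSeries b f G y n) := by
  simp only [rootSeries, rootDifferential_clm_comp f hG, map_sum, map_smul]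

theorem bSeries_zero (a : ButcherTree → ℝ) (f : Y → Y) (y : Y) : bSeries a Y f y 0 = y := rfl

theorem bSeries_of_ne_zero (a : ButcherTree → ℝ) (f : Y → Y) (y : Y) {n : ℕ} (hn : n ≠ 0) :
    bSeries a Y f y n = rootSeries a f f y n := by
  simp only [bSeries, if_neg hn, rootSeries, elementaryDifferential_eq]

theorem sum_pow_smul_bSeries (a : ButcherTree → ℝ) (f : Y → Y) (y : Y) (N : ℕ) (h : ℝ) :
    ∑ i ∈ Finset.range (N + 1), h ^ i • bSeries a Y f y i =
      y + ∑ t ∈ ofOrderLE N, h ^ t.order •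
        ((a t.toRooted / t.branchFactorial) • t.elementaryDifferential f y) := by
  rw [Finset.sum_range_succ', add_comm, pow_zero, one_smul, bSeries_zero,
    ← sum_range_sum_ofOrder_succ]
  congr 1
  refine Finset.sum_congr rfl fun n _ => ?_
  rw [bSeries, if_neg n.succ_ne_zero, Finset.smul_sum]
  exact Finset.sum_congr rfl fun t ht => by rw [mem_ofOrder.1 ht]

theorem sum_pow_smul_rootSeries_succ (b : ButcherTree → ℝ) (f : Y → Y) (G : Y → Z) (y : Y) (N : ℕ)
    (h : ℝ) :
    ∑ i ∈ Finset.range (N + 1), h ^ i • rootSeries b f G y (i + 1) =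
      ∑ t ∈ ofOrderLE (N + 1), h ^ (t.order - 1) •
        ((b t.toRooted / t.branchFactorial) • rootDifferential f G y t) := by
  rw [← sum_range_sum_ofOrder_succ]
  refine Finset.sum_congr rfl fun n _ => ?_
  rw [rootSeries, Finset.smul_sum]
  exact Finset.sum_congr rfl fun t ht => by rw [mem_ofOrder.1 ht, Nat.add_sub_cancel]

theorem taylor_sum_elementaryDifferential (a : ButcherTree → ℝ) (f : Y → Y) (G : Y → Z) (y : Y)
    (N : ℕ) (h : ℝ) :
    (∑ k ∈ Finset.range (N + 1), (k ! : ℝ)⁻¹ • iteratedFDeriv ℝ k G y fun _ =>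
      ∑ t ∈ ofOrderLE N, h ^ t.order •
        ((a t.toRooted / t.branchFactorial) • t.elementaryDifferential f y)) =
      ∑ t ∈ treesWithChildrenLE N, h ^ (t.order - 1) •
        ((childProd a t.toRooted / t.branchFactorial) • rootDifferential f G y t) := by
  rw [sum_treesWithChildrenLE]
  refine Finset.sum_congr rfl fun k _ => ?_
  rw [ContinuousMultilinearMap.map_sum_finset, Finset.smul_sum]
  refine Finset.sum_congr rfl fun c _ => ?_
  simp only [smul_smul]
  rw [ContinuousMultilinearMap.map_smul_univ, smul_smul, childProd_toRooted_node, rootDifferential,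
    PlaneTree.order, branchFactorial, Nat.add_sub_cancel_left, Finset.prod_mul_distrib,
    Finset.prod_pow_eq_pow_sum, Finset.prod_div_distrib]
  congr 1
  push_cast
  rw [div_mul_eq_div_div]
  ring

theorem hasJet_comp_bSeries [CompleteSpace Z] (a : ButcherTree → ℝ) (f : Y → Y) {G : Y → Z}
    (hG : ContDiff ℝ ∞ G) (y : Y) (N : ℕ) :
    HasJet N (fun h : ℝ => G (∑ i ∈ Finset.range (N + 1), h ^ i • bSeries a Y f y i))
      fun n => rootSeries (childProd a) f G y (n + 1) := by
  classical
  set v : ℝ → Y := fun h => ∑ t ∈ ofOrderLE N, h ^ t.order •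
    ((a t.toRooted / t.branchFactorial) • t.elementaryDifferential f y)
  have hv0 : v 0 = 0 := Finset.sum_eq_zero fun t _ => by rw [zero_pow t.order_pos.ne', zero_smul]
  have hvd : DifferentiableAt ℝ v 0 := by fun_prop
  have hvO : (fun h => ‖v h‖ ^ (N + 1)) =O[𝓝 0] fun h : ℝ => h ^ (N + 1) :=
    IsBigO.pow (IsBigO.norm_left (by simpa [hv0] using hvd.isBigO_sub)) _
  have hremainder := ((taylor_remainder_isBigO (contDiff_infty.1 hG (N + 1)) y).comp_tendsto
    (show Tendsto v (𝓝 0) (𝓝 0) by simpa [hv0] using hvd.continuousAt.tendsto)).trans hvO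
  have hlarge : (fun h : ℝ => ∑ t ∈ treesWithChildrenLE N \ ofOrderLE (N + 1),
      h ^ (t.order - 1) • ((childProd a t.toRooted / t.branchFactorial) •
        rootDifferential f G y t)) =o[𝓝 0] fun h : ℝ => h ^ N := by
    refine IsLittleO.fun_sum fun t ht => pow_smul_isLittleO ?_ _
    rw [Finset.mem_sdiff, mem_ofOrderLE] at ht
    omega
  refine ((hremainder.trans_isLittleO (isLittleO_pow_pow N.lt_succ_self)).add
    hlarge).congr_left fun h => ?_
  have htaylor := taylor_sum_elementaryDifferential a f G y N h
  rw [← Finset.sum_sdiff (ofOrderLE_succ_subset N)] at htaylor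
  simp only [Function.comp_apply]
  rw [sum_pow_smul_bSeries, sum_pow_smul_rootSeries_succ, htaylor]
  abel

theorem formalComp_bSeries {Z : Type u} [NormedAddCommGroup Z] [NormedSpace ℝ Z] [CompleteSpace Z]
    (a : ButcherTree → ℝ) (f : Y → Y) {G : Y → Z} (hG : ContDiff ℝ ∞ G) (y : Y) (n : ℕ) :
    formalComp G (bSeries a Y f y) n = rootSeries (childProd a) f G y (n + 1) :=
  formalComp_eq_of_hasJet (contDiff_infty.1 hG n) (hasJet_comp_bSeries a f hG y n)

end ElementaryDifferentials

section FunctionalEquivariance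

open PlaneTree

variable {Y Z : Type u} [NormedAddCommGroup Y] [NormedSpace ℝ Y]
  [NormedAddCommGroup Z] [NormedSpace ℝ Z] {F : Y → Z} {f : Y → Y}

theorem contDiff_fderiv_apply {W : Type*} [NormedAddCommGroup W] [NormedSpace ℝ W] {G : Y → W}
    (hG : ContDiff ℝ ∞ G) (hf : ContDiff ℝ ∞ f) : ContDiff ℝ ∞ fun y => fderiv ℝ G y (f y) :=
  (hG.fderiv_right (by simp)).clm_apply hf

theorem contDiff_augmentedField (hF : ContDiff ℝ ∞ F) (hf : ContDiff ℝ ∞ f) :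
    ContDiff ℝ ∞ (augmentedField F f) :=
  (hf.comp contDiff_fst).prodMk ((contDiff_fderiv_apply hF hf).comp contDiff_fst)

theorem bSeries_augmentedField_fst (hF : ContDiff ℝ ∞ F) (hf : ContDiff ℝ ∞ f)
    (a : ButcherTree → ℝ) (p : Y × Z) (n : ℕ) :
    (bSeries a (Y × Z) (augmentedField F f) p n).1 = bSeries a Y f p.1 n := by
  simp only [bSeries]
  split_ifs
  · rfl
  · rw [Prod.fst_sum]
    refine Finset.sum_congr rfl fun t _ => congrArg (_ • ·) ?_
    exact map_elementaryDifferential (contDiff_augmentedField hF hf) hf (.fst ℝ Y Z)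
      (fun _ => rfl) p t

theorem bSeries_augmentedField_snd (hF : ContDiff ℝ ∞ F) (hf : ContDiff ℝ ∞ f)
    (a : ButcherTree → ℝ) (p : Y × Z) {n : ℕ} (hn : n ≠ 0) :
    (bSeries a (Y × Z) (augmentedField F f) p n).2 =
      rootSeries a f (fun y => fderiv ℝ F y (f y)) p.1 n := by
  have hg := contDiff_augmentedField hF hf
  rw [bSeries_of_ne_zero a _ p hn]
  refine (rootSeries_clm_comp a _ hg (.snd ℝ Y Z) p n).symm.trans ?_
  refine Finset.sum_congr rfl fun t _ => congrArg (_ • ·) ?_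
  exact rootDifferential_comp_clm hg hf (.fst ℝ Y Z) (fun _ => rfl) (contDiff_fderiv_apply hF hf)
    p t

theorem formalComp_graph_eq_bSeries_augmentedField_iff (hF : ContDiff ℝ ∞ F)
    (hf : ContDiff ℝ ∞ f) (a : ButcherTree → ℝ) (y : Y) :
    formalComp (fun x => (x, F x)) (bSeries a Y f y) =
        bSeries a (Y × Z) (augmentedField F f) (y, F y) ↔
      ∀ n ≠ 0, formalComp F (bSeries a Y f y) n =
        rootSeries a f (fun x => fderiv ℝ F x (f x)) y n := by
  have hgraph (n : ℕ) : formalComp (fun x => (x, F x)) (bSeries a Y f y) n =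
      (bSeries a Y f y n, formalComp F (bSeries a Y f y) n) := by
    rw [formalComp_prodMk contDiff_fun_id (contDiff_infty.1 hF n), formalComp_id]
  refine funext_iff.trans ⟨fun h n hn => ?_, fun h n => ?_⟩
  · rw [← bSeries_augmentedField_snd hF hf a (y, F y) hn, ← h n, hgraph]
  · refine (hgraph n).trans (Prod.ext (bSeries_augmentedField_fst hF hf a (y, F y) n).symm ?_)
    obtain rfl | hn := eq_or_ne n 0
    · simp [formalComp, bSeries]
    · rw [bSeries_augmentedField_snd hF hf a (y, F y) hn, h n hn]

theorem bSeries_functionallyEquivariant_affineMaps (a : ButcherTree → ℝ) :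
    FunctionallyEquivariant affineMaps.{u} (bSeries a) := by
  rintro Y Z _ _ _ _ _ _ F ⟨A, hA⟩ f hf y
  obtain ⟨z, L, rfl⟩ : ∃ (z : Z) (L : Y →L[ℝ] Z), F = fun x => z + L x :=
    ⟨A 0, A.contLinear, funext fun x => by
      rw [hA, add_comm]
      exact congrFun A.decomp x⟩
  have hfderiv (x : Y) : fderiv ℝ (fun x => z + L x) x = L := by
    rw [fderiv_const_add, ContinuousLinearMap.fderiv]
  refine (formalComp_graph_eq_bSeries_augmentedField_iff (by fun_prop) hf a y).2 fun n hn => ?_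
  simp only [hfderiv]
  rw [formalComp_const_add _ _ _ hn, formalComp_clm_comp contDiff_fun_id, formalComp_id,
    rootSeries_clm_comp a f hf, bSeries_of_ne_zero a f y hn]

theorem polynomialMaps.contDiff {d : ℕ} (hF : polynomialMaps d Y Z F) : ContDiff ℝ ∞ F := by
  obtain ⟨p, hp⟩ := hF
  rw [funext hp]
  exact ContDiff.sum fun k _ => (p k).contDiff.comp (contDiff_pi.2 fun _ => contDiff_id)

theorem polynomialMaps.snd_sub_comp_fst {d : ℕ} (hd : 1 ≤ d) (hF : polynomialMaps d Y Z F) :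
    polynomialMaps d (Y × Z) Z fun p => p.2 - F p.1 := by
  obtain ⟨p, hp⟩ := hF
  let proj : (k : ℕ) → ContinuousMultilinearMap ℝ (fun _ : Fin k => Y × Z) Z :=
    Pi.single 1 (ContinuousMultilinearMap.ofSubsingleton ℝ (Y × Z) Z 0 (.snd ℝ Y Z))
  refine ⟨fun k => proj k - (p k).compContinuousLinearMap fun _ => .fst ℝ Y Z, fun x => ?_⟩
  simp only [sub_apply, Finset.sum_sub_distrib]
  congr 1
  · rw [Finset.sum_eq_single_of_mem 1 (by simpa using Nat.lt_succ_of_le hd)]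
    · simp [proj]
    · intro k _ hk
      simp [proj, hk]
  · exact hp x.1

theorem isFirstIntegral_snd_sub_comp_fst (hF : Differentiable ℝ F) (f : Y → Y) :
    IsFirstIntegral (fun p : Y × Z => p.2 - F p.1) (augmentedField F f) := by
  intro p
  have hderiv : HasFDerivAt (fun p : Y × Z => p.2 - F p.1)
      (.snd ℝ Y Z - (fderiv ℝ F p.1).comp (.fst ℝ Y Z)) p :=
    hasFDerivAt_snd.sub ((hF p.1).hasFDerivAt.comp p hasFDerivAt_fst)
  rw [hderiv.fderiv]
  exact sub_self _

theorem functionallyEquivariant_polynomialMaps_of_preservesInvariants {d : ℕ} (hd : 1 ≤ d)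
    {a : ButcherTree → ℝ} (ha : PreservesInvariants (polynomialMaps.{u} d) (bSeries a)) :
    FunctionallyEquivariant (polynomialMaps.{u} d) (bSeries a) := by
  intro Y Z _ _ _ _ _ _ F hF f hf y
  have hFs := hF.contDiff
  refine (formalComp_graph_eq_bSeries_augmentedField_iff hFs hf a y).2 fun n hn => ?_
  have hinv := congrFun (ha (Y × Z) Z _ (hF.snd_sub_comp_fst hd) _ (contDiff_augmentedField hFs hf)
    (isFirstIntegral_snd_sub_comp_fst (hFs.differentiable (by simp)) f) (y, F y)) n
  rw [formalComp_snd_sub_comp_fst (contDiff_infty.1 hFs n), if_neg hn, sub_eq_zero,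
    bSeries_augmentedField_snd hFs hf a _ hn] at hinv
  simp only [bSeries_augmentedField_fst hFs hf] at hinv
  exact hinv.symm

end FunctionalEquivariance

section RungeKutta

open Asymptotics Filter Topology ButcherTree

variable {Y Z : Type u} [NormedAddCommGroup Y] [NormedSpace ℝ Y]
  [NormedAddCommGroup Z] [NormedSpace ℝ Z]

/-- The Runge–Kutta tableau `(A, b)` satisfies Cooper's condition `bᵢ aᵢⱼ + bⱼ aⱼᵢ = bᵢ bⱼ`, under
which the method conserves quadratic invariants and, on Hamiltonian systems, the symplectic form. -/
def IsSymplecticTableau {ι : Type*} (A : ι → ι → ℝ) (b : ι → ℝ) : Prop :=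
  ∀ i j, b i * A i j + b j * A j i = b i * b j

theorem quadraticMaps.exists_bilinear {F : Y → Z} (hF : quadraticMaps Y Z F) :
    ∃ (e : Z) (L : Y →L[ℝ] Z) (B : Y →L[ℝ] Y →L[ℝ] Z), ∀ y, F y = e + L y + B y y := by
  obtain ⟨p, hp⟩ := hF
  let curryFin1 := continuousMultilinearCurryFin1 ℝ Y Z
  let B : Y →L[ℝ] Y →L[ℝ] Z :=
    (curryFin1.toContinuousLinearEquiv : _ →L[ℝ] Y →L[ℝ] Z) ∘L (p 2).curryLeft
  refine ⟨p 0 0, curryFin1 (p 1), B, fun y => ?_⟩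
  have hconst : (p 0 fun _ => y) = p 0 0 := congrArg _ (Subsingleton.elim _ _)
  have hlinear : (p 1 fun _ => y) = curryFin1 (p 1) y :=
    congrArg (p 1) (funext fun i => by fin_cases i; rfl)
  have hbilinear : (p 2 fun _ => y) = B y y :=
    congrArg (p 2) (funext fun i => by fin_cases i <;> rfl)
  rw [hp, Finset.sum_range_succ, Finset.sum_range_succ, Finset.sum_range_one, hconst, hlinear,
    hbilinear]

namespace IsSymplecticTableau

section

variable {ι : Type*} [Fintype ι] {A : ι → ι → ℝ} {b : ι → ℝ}

theorem sum_smul_add_sum_smul (hAb : IsSymplecticTableau A b) (B : Y →L[ℝ] Y →L[ℝ] Z) (k : ι → Y) :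
    ∑ i, b i • (B (∑ j, A i j • k j) (k i) + B (k i) (∑ j, A i j • k j)) =
      B (∑ i, b i • k i) (∑ i, b i • k i) := by
  have hswap : ∑ i, ∑ j, (b i * A i j) • B (k j) (k i) =
      ∑ i, ∑ j, (b j * A j i) • B (k i) (k j) := Finset.sum_comm
  have hcross : B (∑ i, b i • k i) (∑ i, b i • k i) =
      ∑ i, ∑ j, (b i * A i j + b j * A j i) • B (k i) (k j) := by
    simp only [map_sum, map_smul, sum_apply, smul_apply, Finset.smul_sum, smul_smul, hAb _ _]
    rw [Finset.sum_comm]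
    simp only [mul_comm]
  rw [hcross]
  simp only [map_sum, map_smul, sum_apply, smul_apply, smul_add, Finset.smul_sum, smul_smul,
    Finset.sum_add_distrib, add_smul, hswap]
  exact add_comm _ _

theorem quadraticMaps_increment (hAb : IsSymplecticTableau A b) {F : Y → Z}
    (hF : quadraticMaps Y Z F) (y : Y) (k : ι → Y) :
    F (y + ∑ i, b i • k i) = F y + ∑ i, b i • fderiv ℝ F (y + ∑ j, A i j • k j) (k i) := by
  obtain ⟨e, L, B, hF⟩ := hF.exists_bilinear
  have hfderiv (x v : Y) : fderiv ℝ F x v = L v + (B x v + B v x) := by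
    have hd : HasFDerivAt (fun y => e + L y + B y y)
        (L + (B.precompR Y x (.id ℝ Y) + B.precompL Y (.id ℝ Y) x)) x :=
      (L.hasFDerivAt.const_add e).add
        (B.hasFDerivAt_of_bilinear (hasFDerivAt_id x) (hasFDerivAt_id x))
    rw [funext hF, hd.fderiv]
    rfl
  have hsum : ∑ i, b i • fderiv ℝ F (y + ∑ j, A i j • k j) (k i) =
      L (∑ i, b i • k i) + B y (∑ i, b i • k i) + B (∑ i, b i • k i) y +
        B (∑ i, b i • k i) (∑ i, b i • k i) := by
    rw [← hAb.sum_smul_add_sum_smul B k]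
    simp only [hfderiv, map_add, map_sum, map_smul, add_apply, sum_apply, smul_apply, smul_add,
      Finset.sum_add_distrib]
    abel
  rw [hsum, hF, hF]
  simp only [map_add, add_apply]
  abel

end

variable {s : ℕ} {A : Fin s → Fin s → ℝ} {b : Fin s → ℝ}

theorem rkStep_apply_eq (hAb : IsSymplecticTableau A b) {F : Y → Z} (hF : quadraticMaps Y Z F)
    {f : Y → Y} (hf : IsFirstIntegral F f) {y₀ y₁ : Y} (h : RKStep A b f y₀ y₁) : F y₁ = F y₀ := by
  obtain ⟨S, hS, rfl⟩ := h
  rw [hAb.quadraticMaps_increment hF y₀ fun i => f (S i)]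
  simp only [← hS, hf _, smul_zero, Finset.sum_const_zero, add_zero]

theorem rkStep_augmentedField_iff (hAb : IsSymplecticTableau A b) {F : Y → Z}
    (hF : quadraticMaps Y Z F) (f : Y → Y) (y₀ : Y) (p : Y × Z) :
    RKStep A b (augmentedField F f) (y₀, F y₀) p ↔
      ∃ y₁ : Y, RKStep A b f y₀ y₁ ∧ p = (y₁, F y₁) := by
  have hpair (w : Fin s → ℝ) (k : Fin s → Y × Z) :
      (y₀, F y₀) + ∑ j, w j • k j = (y₀ + ∑ j, w j • (k j).1, F y₀ + ∑ j, w j • (k j).2) := by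
    refine Prod.ext ?_ ?_
    · rw [Prod.fst_add, Prod.fst_sum]; rfl
    · rw [Prod.snd_add, Prod.snd_sum]; rfl
  constructor
  · rintro ⟨S, hS, rfl⟩
    have hS' (i : Fin s) : (S i).1 = y₀ + ∑ j, A i j • f (S j).1 :=
      congrArg Prod.fst ((hS i).trans (hpair _ _))
    refine ⟨_, ⟨fun i => (S i).1, hS', rfl⟩, ?_⟩
    rw [hpair, hAb.quadraticMaps_increment hF y₀ fun i => f (S i).1]
    simp only [← hS', augmentedField]
  · rintro ⟨y₁, ⟨S, hS, rfl⟩, rfl⟩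
    refine ⟨fun i => (S i, F y₀ + ∑ j, A i j • fderiv ℝ F (S j) (f (S j))), fun i => ?_, ?_⟩
    · simp only [hpair, augmentedField, ← hS]
    · rw [hpair, hAb.quadraticMaps_increment hF y₀ fun i => f (S i)]
      simp only [← hS, augmentedField]

end IsSymplecticTableau

theorem rkWeight_eq_sum_childProd {s : ℕ} (A : Fin s → Fin s → ℝ) (b : Fin s → ℝ)
    (t : ButcherTree) : rkWeight A b t = ∑ i, b i * childProd (rkWeight A (A i)) t := by
  obtain ⟨k, c⟩ := t
  change ∑ i, b i * (PlaneTree.node k c).stageWeight A i =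
    ∑ i, b i * childProd (rkWeight A (A i)) (PlaneTree.node k c).toRooted
  simp only [childProd_toRooted_node]
  rfl

/-- The series in `h` of `h f(Sᵢ)`, for the stages `Sᵢ` of a Runge–Kutta step of size `h` from `y`,
truncated at order `N`. -/
def stageIncrement {s : ℕ} (A : Fin s → Fin s → ℝ) (f : Y → Y) (y : Y) (N : ℕ) (i : Fin s)
    (h : ℝ) : Y :=
  ∑ n ∈ Finset.range N, h ^ (n + 1) • rootSeries (childProd (rkWeight A (A i))) f f y (n + 1)

variable {s : ℕ} (A : Fin s → Fin s → ℝ)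

theorem sum_pow_smul_bSeries_rkWeight (b : Fin s → ℝ) (f : Y → Y) (y : Y) (N : ℕ) (h : ℝ) :
    ∑ n ∈ Finset.range (N + 1), h ^ n • bSeries (rkWeight A b) Y f y n =
      y + ∑ i, b i • stageIncrement A f y N i h := by
  have hcoeff (n : ℕ) : bSeries (rkWeight A b) Y f y (n + 1) =
      ∑ i, b i • rootSeries (childProd (rkWeight A (A i))) f f y (n + 1) := by
    rw [bSeries_of_ne_zero _ _ _ n.succ_ne_zero]
    simp_rw [rootSeries, Finset.smul_sum]
    rw [Finset.sum_comm]
    refine Finset.sum_congr rfl fun t _ => ?_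
    rw [rkWeight_eq_sum_childProd, Finset.sum_div, Finset.sum_smul]
    exact Finset.sum_congr rfl fun i _ => by rw [smul_smul, mul_div_assoc]
  rw [Finset.sum_range_succ', add_comm, pow_zero, one_smul, bSeries_zero]
  simp only [hcoeff, stageIncrement, Finset.smul_sum]
  rw [Finset.sum_comm]
  simp only [smul_comm (h ^ _) (b _)]

theorem smul_comp_sub_stageIncrement_isLittleO [CompleteSpace Y] {f : Y → Y} (hf : ContDiff ℝ ∞ f)
    (y : Y) (N : ℕ) (i : Fin s) :
    (fun h : ℝ => h • f (y + ∑ j, A i j • stageIncrement A f y N j h) - stageIncrement A f y N i h)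
      =o[𝓝 0] fun h : ℝ => h ^ N := by
  set r := rootSeries (childProd (rkWeight A (A i))) f f y
  have hjet := hasJet_comp_bSeries (rkWeight A (A i)) f hf y N
  simp only [sum_pow_smul_bSeries_rkWeight] at hjet
  have hscaled := (isBigO_refl (fun h : ℝ => h) (𝓝 0)).smul_isLittleO hjet
  simp only [smul_eq_mul, ← pow_succ'] at hscaled
  refine ((hscaled.trans (isLittleO_pow_pow N.lt_succ_self)).add
    (pow_smul_isLittleO N.lt_succ_self (r (N + 1)))).congr_left fun h => ?_
  rw [Finset.sum_range_succ, stageIncrement, smul_sub, smul_add, Finset.smul_sum]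
  simp only [smul_smul, ← pow_succ']
  abel

theorem IsSymplecticTableau.preservesInvariants_bSeries {A : Fin s → Fin s → ℝ} {b : Fin s → ℝ}
    (hAb : IsSymplecticTableau A b) :
    PreservesInvariants quadraticMaps.{u} (bSeries (rkWeight A b)) := by
  intro Y Z _ _ _ _ _ _ F hF f hf hinv y
  have hFs : ContDiff ℝ ∞ F := polynomialMaps.contDiff hF
  funext N
  refine formalComp_eq_of_hasJet (d := fun n => if n = 0 then F y else 0) (contDiff_infty.1 hFs N)
    ?_
  set k := fun (i : Fin s) (h : ℝ) => stageIncrement A f y N i h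
  set S := fun (i : Fin s) (h : ℝ) => y + ∑ j, A i j • k j h
  have hk (i : Fin s) : Continuous (k i) := by
    simp only [k, stageIncrement]; fun_prop
  have hterm (i : Fin s) : (fun h => b i • fderiv ℝ F (S i h) (k i h - h • f (S i h)))
      =o[𝓝 0] fun h : ℝ => h ^ N := by
    have hbound : (fun h => fderiv ℝ F (S i h)) =O[𝓝 0] fun _ => (1 : ℝ) :=
      (((hFs.continuous_fderiv (by simp)).comp (by fun_prop)).tendsto 0).isBigO_one ℝ
    have hdefect := (smul_comp_sub_stageIncrement_isLittleO A hf y N i).neg_left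
    simp only [neg_sub] at hdefect
    have hprod := hbound.norm_left.mul_isLittleO hdefect.norm_left
    simp only [one_mul] at hprod
    refine (IsBigO.trans_isLittleO (IsBigO.of_norm_le fun h => ?_) hprod).const_smul_left (b i)
    exact (fderiv ℝ F (S i h)).le_opNorm _
  refine (IsLittleO.fun_sum fun i (_ : i ∈ Finset.univ) => hterm i).congr_left fun h => ?_
  beta_reduce
  rw [sum_pow_smul_bSeries_rkWeight, hAb.quadraticMaps_increment hF, Finset.sum_range_succ']
  simp [S, k, show ∀ x, fderiv ℝ F x (f x) = 0 from hinv]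

end RungeKutta

section GaussLegendre

open Polynomial

theorem exists_derivative_eq_eval_zero_eq_zero (p : ℝ[X]) :
    ∃ Q : ℝ[X], derivative Q = p ∧ Q.eval 0 = 0 ∧ Q.natDegree ≤ p.natDegree + 1 := by
  refine ⟨∑ i ∈ Finset.range (p.natDegree + 1), C (p.coeff i / (i + 1)) * X ^ (i + 1), ?_, ?_, ?_⟩
  · conv_rhs => rw [p.as_sum_range_C_mul_X_pow]
    rw [derivative_sum]
    refine Finset.sum_congr rfl fun i _ => ?_
    rw [derivative_C_mul_X_pow, Nat.add_sub_cancel, Nat.cast_succ,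
      div_mul_cancel₀ _ i.cast_add_one_ne_zero]
  · simp [eval_finsetSum]
  · refine natDegree_sum_le_of_forall_le _ _ fun i hi => ?_
    rw [Finset.mem_range] at hi
    exact (natDegree_C_mul_X_pow_le _ _).trans (by omega)

theorem integral_eval_derivative (Q : ℝ[X]) (a b : ℝ) :
    ∫ x in a..b, (derivative Q).eval x = Q.eval b - Q.eval a :=
  intervalIntegral.integral_eq_sub_of_hasDerivAt (fun x _ => Q.hasDerivAt x)
    ((derivative Q).continuous.intervalIntegrable _ _)

theorem integral_eval_add (p q : ℝ[X]) (a b : ℝ) :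
    ∫ x in a..b, (p + q).eval x = (∫ x in a..b, p.eval x) + ∫ x in a..b, q.eval x := by
  simp only [eval_add]
  exact intervalIntegral.integral_add (p.continuous.intervalIntegrable _ _)
    (q.continuous.intervalIntegrable _ _)

theorem integral_iterate_derivative_mul_eq_zero {w : ℝ[X]} {a b : ℝ} {k : ℕ}
    (ha : ∀ j < k, (derivative^[j] w).eval a = 0) (hb : ∀ j < k, (derivative^[j] w).eval b = 0)
    {q : ℝ[X]} (hq : q.degree < k) : ∫ x in a..b, (derivative^[k] w * q).eval x = 0 := by
  induction k generalizing q with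
  | zero =>
    obtain rfl : q = 0 := by simpa [Nat.WithBot.lt_zero_iff] using hq
    simp
  | succ k ih =>
    have hparts := integral_eval_derivative (derivative^[k] w * q) a b
    rw [derivative_mul, integral_eval_add, eval_mul, eval_mul, ha k k.lt_succ_self,
      hb k k.lt_succ_self, zero_mul, zero_mul, sub_zero] at hparts
    rw [Function.iterate_succ_apply', eq_neg_of_add_eq_zero_left hparts, neg_eq_zero]
    refine ih (fun j hj => ha j (hj.trans k.lt_succ_self))
      (fun j hj => hb j (hj.trans k.lt_succ_self)) ?_
    obtain rfl | hq0 := eq_or_ne q 0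
    · simp
    · exact (degree_derivative_lt hq0).trans_le <| degree_le_of_natDegree_le <|
        Nat.lt_succ_iff.1 ((natDegree_lt_iff_degree_lt hq0).2 hq)

theorem eval_iterate_derivative_eq_zero_of_pow_dvd {r w : ℝ[X]} {x : ℝ} (hr : r.eval x = 0)
    {n j : ℕ} (hw : r ^ n ∣ w) (hj : j < n) : (derivative^[j] w).eval x = 0 := by
  obtain ⟨v, hv⟩ := pow_sub_dvd_iterate_derivative_of_pow_dvd j hw
  rw [hv, eval_mul, eval_pow, hr, zero_pow (Nat.sub_ne_zero_of_lt hj), zero_mul]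

theorem integral_shiftedLegendre_mul_eq_zero (s : ℕ) {q : ℝ[X]} (hq : q.degree < s) :
    ∫ x in (0 : ℝ)..1, ((shiftedLegendre s).map (Int.castRingHom ℝ) * q).eval x = 0 := by
  have hrodrigues := congrArg (Polynomial.map (Int.castRingHom ℝ))
    (factorial_mul_shiftedLegendre_eq s)
  simp only [Polynomial.map_mul, ← iterate_derivative_map, Polynomial.map_pow, Polynomial.map_sub,
    map_X, Polynomial.map_one, Polynomial.map_natCast] at hrodrigues
  have hzero : ∫ x in (0 : ℝ)..1, (derivative^[s] ((X : ℝ[X]) ^ s * (1 - X) ^ s) * q).eval x = 0 :=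
    integral_iterate_derivative_mul_eq_zero
      (fun j hj => eval_iterate_derivative_eq_zero_of_pow_dvd eval_X (dvd_mul_right _ _) hj)
      (fun j hj => eval_iterate_derivative_eq_zero_of_pow_dvd (by simp) (dvd_mul_left _ _) hj) hq
  rw [← hrodrigues] at hzero
  simp only [mul_assoc, eval_mul, eval_natCast, intervalIntegral.integral_const_mul] at hzero ⊢
  exact (mul_eq_zero.1 hzero).resolve_left (Nat.cast_ne_zero.2 s.factorial_ne_zero)

theorem integral_eval_eq_sum_collocationWeights {s : ℕ} {c : Fin s → ℝ}
    (hc : Function.Injective c) {r : ℝ[X]} (hr : r.degree < s) :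
    ∫ x in (0 : ℝ)..1, r.eval x = ∑ i, collocationWeights c i * r.eval (c i) := by
  have hinterp := Lagrange.eq_interpolate (s := Finset.univ) hc.injOn (f := r) (by simpa using hr)
  conv_lhs => rw [hinterp, Lagrange.interpolate_apply]
  simp only [eval_finsetSum, eval_mul, eval_C]
  rw [intervalIntegral.integral_finsetSum fun i _ =>
    Continuous.intervalIntegrable (by fun_prop) _ _]
  refine Finset.sum_congr rfl fun i _ => ?_
  rw [intervalIntegral.integral_const_mul, collocationWeights, mul_comm]

namespace IsGaussNodes

variable {s : ℕ} {c : Fin s → ℝ}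

theorem integral_eval (hc : IsGaussNodes c) {p : ℝ[X]} (hp : p.natDegree < 2 * s) :
    ∫ x in (0 : ℝ)..1, p.eval x = ∑ i, collocationWeights c i * p.eval (c i) := by
  set P := (shiftedLegendre s).map (Int.castRingHom ℝ) with hP
  have hPdegree : P.degree = s := by
    rw [hP, degree_map_eq_of_injective Int.cast_injective, degree_shiftedLegendre]
  have hPnatDegree : P.natDegree = s := natDegree_eq_of_degree_eq_some hPdegree
  have hP0 : P ≠ 0 := by
    rintro h
    simp [h] at hPdegree
  have hsplit : P * (p / P) + p % P = p := EuclideanDomain.div_add_mod p P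
  have hmod : (p % P).degree < s := hPdegree ▸ degree_mod_lt p hP0
  have hdiv : (p / P).degree < s := by
    obtain h | h := eq_or_ne (p / P) 0
    · simp [h]
    · have hmul := natDegree_mul hP0 h
      have hsub := natDegree_sub_le p (p % P)
      rw [← eq_sub_of_add_eq hsplit, hmul, hPnatDegree] at hsub
      have hmod' := natDegree_le_of_degree_le hmod.le
      rw [degree_eq_natDegree h, Nat.cast_lt]
      omega
  have hroot (i : Fin s) : P.eval (c i) = 0 := by
    rw [hP, eval_map]
    exact hc.2 i
  rw [← hsplit, integral_eval_add, integral_shiftedLegendre_mul_eq_zero s hdiv, zero_add,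
    integral_eval_eq_sum_collocationWeights hc.1 hmod]
  simp only [eval_add, eval_mul, hroot, zero_mul, zero_add]

theorem collocationWeights_mul_eq_integral (hc : IsGaussNodes c) {q : ℝ[X]}
    (hq : q.natDegree ≤ s) (i : Fin s) :
    collocationWeights c i * q.eval (c i) =
      ∫ x in (0 : ℝ)..1, (Lagrange.basis Finset.univ c i * q).eval x := by
  have hbasis : (Lagrange.basis Finset.univ c i).natDegree = s - 1 := by
    simpa using Lagrange.natDegree_basis hc.1.injOn (Finset.mem_univ i)
  have hdegree : (Lagrange.basis Finset.univ c i * q).natDegree < 2 * s := by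
    have := i.pos
    refine natDegree_mul_le.trans_lt ?_
    omega
  rw [hc.integral_eval hdegree, Finset.sum_eq_single_of_mem i (Finset.mem_univ i)]
  · rw [eval_mul, Lagrange.eval_basis_self hc.1.injOn (Finset.mem_univ i), one_mul]
  · intro k _ hk
    rw [eval_mul, Lagrange.eval_basis_of_ne hk.symm (Finset.mem_univ k), zero_mul, mul_zero]

theorem isSymplecticTableau (hc : IsGaussNodes c) :
    IsSymplecticTableau (collocationMatrix c) (collocationWeights c) := by
  intro i j
  choose Q hQ hQ0 hQdegree using fun i =>
    exists_derivative_eq_eval_zero_eq_zero (Lagrange.basis Finset.univ c i)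
  have hintegral (i : Fin s) (x : ℝ) :
      ∫ y in (0 : ℝ)..x, (Lagrange.basis Finset.univ c i).eval y = (Q i).eval x := by
    rw [← hQ i, integral_eval_derivative, hQ0, sub_zero]
  have hdegree (i : Fin s) : (Q i).natDegree ≤ s := by
    have hbasis := Lagrange.natDegree_basis (s := Finset.univ) hc.1.injOn (Finset.mem_univ i)
    rw [Finset.card_univ, Fintype.card_fin] at hbasis
    have := i.pos
    have := hQdegree i
    omega
  simp only [collocationMatrix, hintegral]
  rw [hc.collocationWeights_mul_eq_integral (hdegree j),
    hc.collocationWeights_mul_eq_integral (hdegree i), ← integral_eval_add]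
  have hparts := integral_eval_derivative (Q i * Q j) 0 1
  rw [derivative_mul, hQ, hQ, eval_mul, eval_mul, hQ0, zero_mul, sub_zero] at hparts
  simp only [collocationWeights, hintegral]
  rw [← hparts, mul_comm (Q i)]

end IsGaussNodes

end GaussLegendre

section HomogeneousDerivatives

variable {Y Z : Type*} [NormedAddCommGroup Y] [NormedSpace ℝ Y]
  [NormedAddCommGroup Z] [NormedSpace ℝ Z]

theorem iteratedFDeriv_zero_of_homogeneous {k m : ℕ} (hkm : k ≠ m) {G : Y → Z}
    (hG : ContDiff ℝ m G) (hhom : ∀ (r : ℝ) (y : Y), G (r • y) = r ^ k • G y) :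
    iteratedFDeriv ℝ m G 0 = 0 := by
  have hscale : (2 : ℝ) ^ m • iteratedFDeriv ℝ m G 0 = (2 : ℝ) ^ k • iteratedFDeriv ℝ m G 0 := by
    have hzero := congrFun (iteratedFDeriv_comp_const_smul (2 : ℝ) hG) 0
    simp only [hhom, smul_zero] at hzero
    rw [← hzero]
    exact iteratedFDeriv_const_smul_apply hG.contDiffAt
  rw [← sub_eq_zero, ← sub_smul, smul_eq_zero, sub_eq_zero] at hscale
  exact hscale.resolve_left fun h =>
    hkm (pow_right_injective₀ (by norm_num : (0 : ℝ) < 2) (by norm_num) h).symm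

theorem contDiff_prod_clm {k : ℕ} (l : Fin k → Y →L[ℝ] ℝ) {n : WithTop ℕ∞} :
    ContDiff ℝ n fun y => ∏ i, l i y :=
  contDiff_prod fun i _ => (l i).contDiff

theorem iteratedFDeriv_prod_clm_zero {k : ℕ} (l : Fin k → Y →L[ℝ] ℝ) (v : Fin k → Y) :
    iteratedFDeriv ℝ k (fun y => ∏ i, l i y) 0 v = ∑ e : Equiv.Perm (Fin k), ∏ i, l i (v (e i)) :=
  ((ContinuousMultilinearMap.mkPiAlgebra ℝ (Fin k) ℝ).compContinuousLinearMap
    l).iteratedFDeriv_comp_diagonal 0 v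

theorem iteratedFDeriv_prod_clm_zero_of_ne {k m : ℕ} (hkm : k ≠ m) (l : Fin k → Y →L[ℝ] ℝ) :
    iteratedFDeriv ℝ m (fun y => ∏ i, l i y) 0 = 0 :=
  iteratedFDeriv_zero_of_homogeneous hkm (contDiff_prod_clm l) fun r y => by
    simp [Finset.prod_mul_distrib]

end HomogeneousDerivatives

section TreeField

open ButcherTree PlaneTree

instance (N : ℕ) : Fintype {t : ButcherTree // t.order ≤ N} :=
  have : Finite {t : ButcherTree // t.order ≤ N} :=
    Finite.of_surjective (fun t : ofOrderLE N => ⟨t.1.toRooted, mem_ofOrderLE.1 t.2⟩) <| by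
      rintro ⟨⟨t⟩, ht⟩
      exact ⟨⟨t, mem_ofOrderLE.2 ht⟩, rfl⟩
  Fintype.ofFinite _

/-- Euclidean space with one coordinate for each rooted tree with at most `N` vertices, the phase
space of `treeField`. -/
abbrev TreeSpace (N : ℕ) : Type u := ULift.{u} {t : ButcherTree // t.order ≤ N} → ℝ

/-- The coordinate `x_t` of a tree `t` on `TreeSpace N`; it is `0` if `t` has more than `N`
vertices. -/
def treeCoord (N : ℕ) (t : ButcherTree) : TreeSpace.{u} N →L[ℝ] ℝ :=
  if h : t.order ≤ N then ContinuousLinearMap.proj ⟨⟨t, h⟩⟩ else 0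

/-- The product of the coordinates of the subtrees at the root of `T`. -/
def treeMonomial (N : ℕ) (T : ButcherTree) (y : TreeSpace.{u} N) : ℝ :=
  (T.children.map fun t => treeCoord N t y).prod

/-- The vector field `ẋ_T = x_{t₁} ⋯ x_{tₖ}` for `T = [t₁, …, tₖ]`. Its elementary differentials at
`0` separate rooted trees: only that of `T` has a nonzero `T`-coordinate. -/
def treeField (N : ℕ) (y : TreeSpace.{u} N) : TreeSpace.{u} N := fun i => treeMonomial N i.down.1 y

variable {N : ℕ}

theorem treeMonomial_toRooted_node {k : ℕ} (c : Fin k → PlaneTree) :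
    treeMonomial.{u} N (node k c).toRooted = fun y => ∏ i, treeCoord N (c i).toRooted y := by
  funext y
  rw [treeMonomial, children_toRooted_node, Multiset.map_map]
  rfl

theorem contDiff_treeMonomial (T : ButcherTree) {n : WithTop ℕ∞} :
    ContDiff ℝ n (treeMonomial.{u} N T) := by
  obtain ⟨k, c⟩ := T
  change ContDiff ℝ n (treeMonomial N (node k c).toRooted)
  rw [treeMonomial_toRooted_node]
  exact contDiff_prod_clm _

theorem contDiff_treeField {n : WithTop ℕ∞} : ContDiff ℝ n (treeField.{u} N) :=
  contDiff_pi.2 fun i => contDiff_treeMonomial i.down.1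

theorem treeCoord_treeField {t : ButcherTree} (ht : t.order ≤ N) (y : TreeSpace.{u} N) :
    treeCoord N t (treeField N y) = treeMonomial N t y := by
  rw [treeCoord, dif_pos ht]; rfl

theorem treeCoord_elementaryDifferential {s : ButcherTree} (hs : s.order ≤ N) (y : TreeSpace.{u} N)
    (t : PlaneTree) : treeCoord N s (t.elementaryDifferential (treeField N) y) =
      rootDifferential (treeField N) (treeMonomial N s) y t := by
  rw [elementaryDifferential_eq, ← rootDifferential_clm_comp _ contDiff_treeField]
  simp only [treeCoord_treeField hs]

theorem treeCoord_bSeries {s : ButcherTree} (hs : s.order ≤ N) (a : ButcherTree → ℝ) {n : ℕ}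
    (hn : n ≠ 0) : treeCoord N s (bSeries a (TreeSpace.{u} N) (treeField N) 0 n) =
      rootSeries a (treeField.{u} N) (treeMonomial N s) 0 n := by
  rw [bSeries_of_ne_zero a _ _ hn, ← rootSeries_clm_comp a _ contDiff_treeField]
  exact congrArg (fun G => rootSeries a (treeField N) G 0 n) (funext (treeCoord_treeField hs))

theorem toRooted_eq_of_rootDifferential_treeMonomial_ne_zero {T : ButcherTree}
    (hT : ∀ s ∈ T.children, s.order ≤ N) {t : PlaneTree}
    (h : rootDifferential (treeField.{u} N) (treeMonomial N T) 0 t ≠ 0) : t.toRooted = T := by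
  obtain ⟨T⟩ := T
  change ∀ s ∈ T.toRooted.children, s.order ≤ N at hT
  change rootDifferential (treeField.{u} N) (treeMonomial N T.toRooted) 0 t ≠ 0 at h
  change t.toRooted = T.toRooted
  induction T generalizing t with
  | node k c ih =>
    obtain ⟨m, c'⟩ := t
    rw [treeMonomial_toRooted_node, rootDifferential] at h
    obtain rfl : k = m := by
      by_contra hkm
      rw [iteratedFDeriv_prod_clm_zero_of_ne hkm] at h
      exact h rfl
    rw [iteratedFDeriv_prod_clm_zero] at h
    obtain ⟨e, _, he⟩ := Finset.exists_ne_zero_of_sum_ne_zero h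
    rw [Finset.prod_ne_zero_iff] at he
    rw [← toRooted_node_perm c' e]
    refine toRooted_node_congr fun i => ?_
    have hi : (c i).toRooted.order ≤ N :=
      hT _ (children_toRooted_node c ▸ Multiset.mem_map_of_mem _ (Finset.mem_univ_val i))
    have hei := he i (Finset.mem_univ i)
    rw [treeCoord_elementaryDifferential hi] at hei
    exact ih i (fun s hs => (order_lt_of_mem_children hs).le.trans hi) hei

theorem treeMonomial_sum_pow_smul {x : ℕ → TreeSpace.{u} N} {T : ButcherTree} {K : ℕ}
    (hK : T.order ≤ K + 1)
    (hx : ∀ s ∈ T.children, ∀ i, treeCoord N s (x i) = if i = s.order then 1 else 0) (h : ℝ) :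
    treeMonomial N T (∑ i ∈ Finset.range (K + 1), h ^ i • x i) = h ^ (T.order - 1) := by
  have hcoord (s : ButcherTree) (hs : s ∈ T.children) :
      treeCoord N s (∑ i ∈ Finset.range (K + 1), h ^ i • x i) = h ^ s.order := by
    have := order_lt_of_mem_children hs
    simp [hx s hs, show s.order < K + 1 by omega]
  have hpow (M : Multiset ButcherTree) :
      (M.map fun s => h ^ s.order).prod = h ^ (M.map ButcherTree.order).sum := by
    induction M using Multiset.induction_on with
    | empty => simp
    | cons s M ih => simp [ih, pow_add]
  rw [treeMonomial, Multiset.map_congr rfl hcoord, hpow, T.order_eq, Nat.add_sub_cancel_left]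

theorem rootSeries_one_treeMonomial {T : ButcherTree} (hT : ∀ s ∈ T.children, s.order ≤ N) {n : ℕ}
    (hn : n ≠ 0) : rootSeries (fun _ => 1) (treeField.{u} N) (treeMonomial N T) 0 n =
      if n = T.order then 1 else 0 := by
  set K := n + T.order
  have hpos := T.order_pos
  have hcurve := treeMonomial_sum_pow_smul (T := T) (K := K)
    (x := bSeries (fun _ => 1) (TreeSpace.{u} N) (treeField N) 0) (by omega) fun s hs i => by
      have := order_lt_of_mem_children hs
      obtain rfl | hi := eq_or_ne i 0
      · rw [bSeries_zero, map_zero, if_neg s.order_pos.ne]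
      · rw [treeCoord_bSeries (hT s hs) _ hi]
        exact rootSeries_one_treeMonomial
          (fun s' hs' => (order_lt_of_mem_children hs').le.trans (hT s hs)) hi
  have hjet := hasJet_comp_bSeries (fun _ => 1) (treeField.{u} N) (contDiff_treeMonomial T) 0 K
  simp only [hcurve] at hjet
  have hpow : HasJet K (fun h : ℝ => h ^ (T.order - 1))
      fun i => if i = T.order - 1 then 1 else 0 := by
    simp [HasJet, show T.order - 1 < K + 1 by omega]
  have hchild : childProd (fun _ => 1) = fun _ => 1 := by
    funext t
    simp [childProd]
  have heq := hjet.unique hpow (n - 1) (by omega)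
  rw [hchild, Nat.sub_add_cancel (Nat.pos_of_ne_zero hn)] at heq
  rw [heq]
  exact if_congr (by omega) rfl rfl
termination_by T.order

theorem rootSeries_treeMonomial (b : ButcherTree → ℝ) {T : ButcherTree}
    (hT : ∀ s ∈ T.children, s.order ≤ N) {n : ℕ} (hn : n ≠ 0) :
    rootSeries b (treeField.{u} N) (treeMonomial N T) 0 n = if n = T.order then b T else 0 := by
  have hfactor : rootSeries b (treeField.{u} N) (treeMonomial N T) 0 n =
      b T * rootSeries (fun _ => 1) (treeField.{u} N) (treeMonomial N T) 0 n := by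
    rw [rootSeries, rootSeries, Finset.mul_sum]
    refine Finset.sum_congr rfl fun t _ => ?_
    by_cases ht : rootDifferential (treeField.{u} N) (treeMonomial N T) 0 t = 0
    · simp [ht]
    · rw [toRooted_eq_of_rootDifferential_treeMonomial_ne_zero hT ht, smul_eq_mul, smul_eq_mul]
      ring
  rw [hfactor, rootSeries_one_treeMonomial hT hn, mul_ite, mul_one, mul_zero]

end TreeField

section RootSums

open ButcherTree PlaneTree

section

variable {Y : Type u} [NormedAddCommGroup Y] [NormedSpace ℝ Y]

theorem rootSeries_multiset_sum {Z ι : Type*} [NormedAddCommGroup Z] [NormedSpace ℝ Z]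
    (b : ButcherTree → ℝ) (f : Y → Y) {G : ι → Y → Z} (hG : ∀ i, ContDiff ℝ ∞ (G i))
    (M : Multiset ι) (y : Y) (n : ℕ) :
    rootSeries b f (fun x => (M.map fun i => G i x).sum) y n =
      (M.map fun i => rootSeries b f (G i) y n).sum := by
  classical
  have huniv (g : ι → Z) : (M.map g).sum = ∑ i : M, g i := by
    rw [← Multiset.map_univ, Finset.sum]
  simp only [huniv, rootSeries, rootDifferential_sum f fun _ _ => hG _, Finset.smul_sum]
  exact Finset.sum_comm

variable {Z : Type u} [NormedAddCommGroup Z] [NormedSpace ℝ Z]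

theorem polynomialMaps_prod_clm {d k : ℕ} (hk : k ≤ d) (l : Fin k → Y →L[ℝ] ℝ) (L : ℝ →L[ℝ] Z) :
    polynomialMaps d Y Z fun y => L (∏ i, l i y) := by
  let p : (m : ℕ) → ContinuousMultilinearMap ℝ (fun _ : Fin m => Y) Z :=
    Function.update 0 k (L.compContinuousMultilinearMap
      ((ContinuousMultilinearMap.mkPiAlgebra ℝ (Fin k) ℝ).compContinuousLinearMap l))
  refine ⟨p, fun y => ?_⟩
  rw [Finset.sum_eq_single_of_mem k (Finset.mem_range_succ_iff.2 hk) fun m _ hm => by simp [p, hm]]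
  simp [p]

-- `FunctionallyEquivariant` lives in one universe, hence the transport along `L`.
theorem FunctionallyEquivariant.rootSeries_childProd [CompleteSpace Y] [CompleteSpace Z]
    {W : Type*} [NormedAddCommGroup W] [NormedSpace ℝ W] {𝓕 : MapClass.{u}}
    {a : ButcherTree → ℝ} (ha : FunctionallyEquivariant 𝓕 (bSeries a)) {G : Y → W} (L : W ≃L[ℝ] Z)
    (hG : 𝓕 Y Z fun y => L (G y)) (hGd : ContDiff ℝ ∞ G) {f : Y → Y}
    (hf : ContDiff ℝ ∞ f) (y : Y) {n : ℕ} (hn : n ≠ 0) :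
    rootSeries (childProd a) f G y (n + 1) =
      rootSeries a f (fun x => fderiv ℝ G x (f x)) y n := by
  have hLG : ContDiff ℝ ∞ fun x => L (G x) := L.contDiff.comp hGd
  have hfderiv (x : Y) : fderiv ℝ (fun x => L (G x)) x (f x) = L (fderiv ℝ G x (f x)) :=
    congrArg (fun M => M (f x)) L.comp_fderiv
  have h := (formalComp_graph_eq_bSeries_augmentedField_iff hLG hf a y).1 (ha Y Z _ hG f hf y) n hn
  simp only [formalComp_bSeries a f hLG, hfderiv] at h
  refine L.injective ?_
  refine (rootSeries_clm_comp _ f hGd (L : W →L[ℝ] Z) y _).symm.trans (h.trans ?_)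
  exact rootSeries_clm_comp a f (contDiff_fderiv_apply hGd hf) (L : W →L[ℝ] Z) y n

end

theorem fderiv_treeMonomial_treeField {N : ℕ} {T : ButcherTree}
    (hT : ∀ s ∈ T.children, s.order ≤ N) (y : TreeSpace.{u} N) :
    fderiv ℝ (treeMonomial N T) y (treeField N y) =
      (T.children.map fun s => treeMonomial N (s.graft (T.children.erase s)) y).sum := by
  have h := HasFDerivAt.multiset_prod (u := T.children) (x := y) (𝕜 := ℝ)
    (g := fun s => treeCoord.{u} N s) (g' := treeCoord.{u} N) fun s _ => (treeCoord N s).hasFDerivAt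
  refine (congrArg (fun M => M (treeField N y)) h.fderiv).trans ?_
  refine (map_multiset_sum (ContinuousLinearMap.apply ℝ ℝ (treeField N y)) _).trans ?_
  rw [Multiset.map_map]
  refine congrArg Multiset.sum (Multiset.map_congr rfl fun s hs => ?_)
  rw [Function.comp_apply, ContinuousLinearMap.apply_apply, smul_apply, smul_eq_mul, mul_comm,
    treeCoord_treeField (hT s hs), treeMonomial, treeMonomial, children_graft, Multiset.map_add,
    Multiset.prod_add]

theorem polynomialMaps_treeMonomial {Z : Type u} [NormedAddCommGroup Z] [NormedSpace ℝ Z] {d N : ℕ}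
    {T : ButcherTree} (hT : T.children.card ≤ d) (L : ℝ →L[ℝ] Z) :
    polynomialMaps d (TreeSpace.{u} N) Z fun y => L (treeMonomial N T y) := by
  obtain ⟨k, c⟩ := T
  change (node k c).toRooted.children.card ≤ d at hT
  change polynomialMaps d _ Z fun y => L (treeMonomial N (node k c).toRooted y)
  rw [children_toRooted_node, Multiset.card_map, Finset.card_val, Finset.card_fin] at hT
  rw [treeMonomial_toRooted_node]
  exact polynomialMaps_prod_clm hT _ L

/-- The root-sum rule for the forest `S = {s₁, …, sₖ}`: the product `a(s₁) ⋯ a(sₖ)` is the sum of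
the values of `a` at the `k` trees made of `S` by choosing one `sᵢ` and attaching the others to its
root. It expresses equivariance with respect to a product of `k` coordinates. -/
def RootSumRule (a : ButcherTree → ℝ) (S : Multiset ButcherTree) : Prop :=
  (S.map a).prod = (S.map fun s => a (s.graft (S.erase s))).sum

theorem FunctionallyEquivariant.rootSumRule {d : ℕ} {a : ButcherTree → ℝ}
    (ha : FunctionallyEquivariant (polynomialMaps.{u} d) (bSeries a)) {S : Multiset ButcherTree}
    (hS : S ≠ 0) (hSd : S.card ≤ d) : RootSumRule a S := by
  set n := (S.map ButcherTree.order).sum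
  have hle {s : ButcherTree} (hs : s ∈ S) : s.order ≤ n :=
    Multiset.le_sum_of_mem (Multiset.mem_map_of_mem _ hs)
  have hn0 : n ≠ 0 := by
    obtain ⟨s, hs⟩ := Multiset.exists_mem_of_ne_zero hS
    exact (s.order_pos.trans_le (hle hs)).ne'
  have hT : ∀ s ∈ (join S).children, s.order ≤ n := fun s hs => hle (children_join S ▸ hs)
  let up : ℝ ≃L[ℝ] ULift.{u} ℝ := ContinuousLinearEquiv.ulift.symm
  have hcard : (join S).children.card ≤ d := by rwa [children_join]
  have h := ha.rootSeries_childProd (G := treeMonomial n (join S)) up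
    (polynomialMaps_treeMonomial hcard (up : ℝ →L[ℝ] ULift.{u} ℝ)) (contDiff_treeMonomial _)
    contDiff_treeField 0 hn0
  have hroot : (join S).order = n + 1 := by rw [order_eq, children_join, add_comm]
  rw [rootSeries_treeMonomial _ hT n.succ_ne_zero, if_pos hroot.symm] at h
  simp only [fderiv_treeMonomial_treeField hT, children_join] at h
  rw [rootSeries_multiset_sum _ _ fun _ => contDiff_treeMonomial _, childProd, children_join] at h
  refine h.trans (congrArg Multiset.sum (Multiset.map_congr rfl fun s hs => ?_))
  have hgraft : (s.graft (S.erase s)).order = n := by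
    rw [order_graft, Multiset.sum_map_erase hs]
  rw [rootSeries_treeMonomial a (fun _ h' => (order_lt_of_mem_children h').le.trans_eq hgraft) hn0,
    if_pos hgraft.symm]

end RootSums

section ExactFlow

open ButcherTree PlaneTree

variable {a : ButcherTree → ℝ}

theorem rootSumRule_cons {s : ButcherTree} {M : Multiset ButcherTree} :
    RootSumRule a (s ::ₘ M) ↔ a s * (M.map a).prod =
      a (s.graft M) + (M.map fun r => a (r.graft (s ::ₘ M.erase r))).sum := by
  have htail : (M.map fun r => a (r.graft ((s ::ₘ M).erase r))) =
      M.map fun r => a (r.graft (s ::ₘ M.erase r)) :=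
    Multiset.map_congr rfl fun r hr => by rw [Multiset.erase_cons_tail_of_mem hr]
  rw [RootSumRule, Multiset.map_cons, Multiset.map_cons, Multiset.prod_cons, Multiset.sum_cons,
    Multiset.erase_cons_head, htail]

theorem rootSumRule_pair {s t : ButcherTree} :
    RootSumRule a {s, t} ↔ a s * a t = a (s.graft {t}) + a (t.graft {s}) := by
  rw [Multiset.insert_eq_cons, rootSumRule_cons]
  simp

theorem rootSumRule_triple {x s t : ButcherTree} :
    RootSumRule a {x, s, t} ↔
      a x * (a s * a t) = a (x.graft {s, t}) + (a (s.graft {x, t}) + a (t.graft {x, s})) := by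
  have herase : (s ::ₘ {t}).erase t = {s} := by
    rw [← Multiset.cons_zero, Multiset.cons_swap, Multiset.erase_cons_head, Multiset.cons_zero]
  rw [Multiset.insert_eq_cons, rootSumRule_cons]
  simp [herase]

theorem apply_graft_pair (h : ∀ S : Multiset ButcherTree, S ≠ 0 → S.card ≤ 3 → RootSumRule a S)
    (x s t : ButcherTree) :
    a (x.graft {s, t}) = a (x.graft {s.graft {t}}) + a (x.graft {t.graft {s}}) := by
  have hpair (u v : ButcherTree) : a u * a v = a (u.graft {v}) + a (v.graft {u}) :=
    rootSumRule_pair.1 (h _ (by simp) (by simp))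
  have htriple := rootSumRule_triple.1 (h {x, s, t} (by simp) (by simp))
  have hs := hpair x (s.graft {t})
  have ht := hpair x (t.graft {s})
  rw [graft_graft, Multiset.singleton_add, ← Multiset.insert_eq_cons, Multiset.pair_comm] at hs ht
  linear_combination hs + ht - htriple + a x * hpair s t

theorem rootSumRule_of_card_le_three
    (h : ∀ S : Multiset ButcherTree, S ≠ 0 → S.card ≤ 3 → RootSumRule a S)
    {S : Multiset ButcherTree} (hS : S ≠ 0) : RootSumRule a S := by
  obtain ⟨s, hs⟩ := Multiset.exists_mem_of_ne_zero hS
  obtain ⟨M, rfl⟩ := Multiset.exists_cons_of_mem hs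
  induction M using Multiset.induction_on generalizing s with
  | empty => exact h _ (by simp) (by simp)
  | cons t M ih =>
    have hst := rootSumRule_cons.1 (ih (s.graft {t}) (by simp) (by simp))
    have hts := rootSumRule_cons.1 (ih (t.graft {s}) (by simp) (by simp))
    have hpair := rootSumRule_pair.1 (h {s, t} (by simp) (by simp))
    have hsplit (r : ButcherTree) : a (r.graft (s ::ₘ t ::ₘ M.erase r)) =
        a (r.graft (s.graft {t} ::ₘ M.erase r)) + a (r.graft (t.graft {s} ::ₘ M.erase r)) := by
      have := apply_graft_pair h (r.graft (M.erase r)) s t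
      simp only [graft_graft, Multiset.insert_eq_cons, ← Multiset.singleton_add] at this ⊢
      convert this using 3 <;> abel_nf
    have hgraft (u v : ButcherTree) : (u.graft {v}).graft M = u.graft (v ::ₘ M) := by
      rw [graft_graft, Multiset.singleton_add]
    rw [hgraft] at hst hts
    have hhead : (t ::ₘ M).map (fun r => a (r.graft (s ::ₘ (t ::ₘ M).erase r))) =
        a (t.graft (s ::ₘ M)) ::ₘ M.map fun r => a (r.graft (s ::ₘ t ::ₘ M.erase r)) := by
      rw [Multiset.map_cons, Multiset.erase_cons_head]
      refine congrArg _ (Multiset.map_congr rfl fun r hr => ?_)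
      rw [Multiset.erase_cons_tail_of_mem hr]
    rw [rootSumRule_cons, hhead, Multiset.sum_cons, Multiset.map_cons, Multiset.prod_cons,
      Multiset.map_congr rfl fun r _ => hsplit r, Multiset.sum_map_add]
    linear_combination hst + hts + (M.map a).prod * hpair

/-- The defect `|t| a(t) - a(•) a(t₁) ⋯ a(tₖ)` of the recursion that characterizes the coefficients
of the exact flow with time rescaled by `a(•)`, at the tree `t = [t₁, …, tₖ]`. -/
def flowDefect (a : ButcherTree → ℝ) (t : ButcherTree) : ℝ :=
  t.order * a t - a leaf * childProd a t

theorem flowDefect_leaf : flowDefect a leaf = 0 := by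
  rw [flowDefect, order_leaf, childProd_leaf]; simp

theorem sum_flowDefect_graft_erase {S : Multiset ButcherTree} (hrule : RootSumRule a S)
    (hS : ∀ s ∈ S, flowDefect a s = 0) :
    (S.map fun s => flowDefect a (s.graft (S.erase s))).sum = 0 := by
  have hterm (s : ButcherTree) (hs : s ∈ S) : flowDefect a (s.graft (S.erase s)) =
      (S.map ButcherTree.order).sum * a (s.graft (S.erase s)) - s.order * (S.map a).prod := by
    rw [flowDefect, order_graft, Multiset.sum_map_erase hs, childProd_graft, ← mul_assoc,
      ← sub_eq_zero.1 (hS s hs), mul_assoc, Multiset.prod_map_erase hs]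
  rw [Multiset.map_congr rfl hterm, Multiset.sum_map_sub, Multiset.sum_map_mul_left, ← hrule,
    Multiset.sum_map_mul_right, Nat.cast_multiset_sum, Multiset.map_map, sub_eq_zero]
  rfl

theorem flowDefect_eq_zero (h : ∀ S : Multiset ButcherTree, S ≠ 0 → RootSumRule a S)
    (t : ButcherTree) : flowDefect a t = 0 := by
  set S := leaf ::ₘ t.children with hS
  have hchildren : ∀ s ∈ S, flowDefect a s = 0 := by
    intro s hs
    obtain rfl | hs := Multiset.mem_cons.1 hs
    · exact flowDefect_leaf
    · have := order_lt_of_mem_children hs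
      exact flowDefect_eq_zero h s
  have hleaf : leaf.graft (S.erase leaf) = t := by
    rw [hS, Multiset.erase_cons_head, leaf_graft_children]
  have hvanish : ∀ s ≠ leaf, s ∈ S → flowDefect a (s.graft (S.erase s)) = 0 := by
    intro s hs_ne hs
    have hcard : t.children.card < (s.graft (S.erase s)).children.card := by
      have hchildren_ne : s.children ≠ 0 := fun h0 => hs_ne (by rw [← join_children s, h0, leaf])
      have := Multiset.card_pos.2 hchildren_ne
      rw [children_graft, Multiset.card_add, Multiset.card_erase_of_mem hs, hS, Multiset.card_cons,
        Nat.pred_succ]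
      omega
    have horder : (s.graft (S.erase s)).order = t.order := by
      rw [order_graft, Multiset.sum_map_erase hs, hS, Multiset.map_cons, Multiset.sum_cons,
        order_leaf, ← order_eq]
    have : t.order - (s.graft (S.erase s)).children.card <
        t.order - t.children.card := by
      have := card_children_lt_order (s.graft (S.erase s))
      omega
    exact flowDefect_eq_zero h (s.graft (S.erase s))
  have hsum := sum_flowDefect_graft_erase (h S (Multiset.cons_ne_zero)) hchildren
  rw [Multiset.sum_map_eq_nsmul_single leaf hvanish, hleaf] at hsum
  exact (smul_eq_zero.1 hsum).resolve_left (by simp [S])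
termination_by (t.order, t.order - t.children.card)
decreasing_by
  · exact Prod.Lex.left _ _ this
  · rw [horder]
    exact Prod.Lex.right _ this

theorem isExactFlow_bSeries {r : ℝ} (h : ∀ t : ButcherTree, t.order * a t = r * childProd a t) :
    IsExactFlow.{u} r (bSeries a) := by
  intro Y _ _ _ f hf y
  refine ⟨rfl, fun n => ?_⟩
  rw [formalComp_bSeries a f hf, bSeries_of_ne_zero a f y n.succ_ne_zero, rootSeries, rootSeries,
    Finset.smul_sum, Finset.smul_sum]
  refine Finset.sum_congr rfl fun t ht => ?_
  have ht' := h t.toRooted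
  rw [order_toRooted, mem_ofOrder.1 ht] at ht'
  push_cast at ht'
  rw [smul_smul, smul_smul, ← mul_div_assoc, ← mul_div_assoc, ht']

theorem isExactFlow_of_functionallyEquivariant_cubicMaps
    (ha : FunctionallyEquivariant cubicMaps.{u} (bSeries a)) :
    IsExactFlow.{u} (a leaf) (bSeries a) :=
  isExactFlow_bSeries fun t => sub_eq_zero.1 <|
    flowDefect_eq_zero (fun _ => rootSumRule_of_card_le_three fun _ => ha.rootSumRule) t

end ExactFlow

end

theorem mainTheorem3_general :
    (∀ a : ButcherTree → ℝ, FunctionallyEquivariant affineMaps.{u} (bSeries a)) ∧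
    (∀ (d : ℕ) (a : ButcherTree → ℝ), 1 ≤ d →
      PreservesInvariants (polynomialMaps.{u} d) (bSeries a) →
        FunctionallyEquivariant (polynomialMaps.{u} d) (bSeries a)) ∧
    (∀ (s : ℕ) (A : Fin s → Fin s → ℝ) (b : Fin s → ℝ), IsSymplecticTableau A b →
      PreservesInvariants quadraticMaps.{u} (bSeries (rkWeight A b)) ∧
      FunctionallyEquivariant quadraticMaps.{u} (bSeries (rkWeight A b)) ∧
      ∀ (Y Z : Type u) [NormedAddCommGroup Y] [NormedSpace ℝ Y] [NormedAddCommGroup Z]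
        [NormedSpace ℝ Z] (F : Y → Z), quadraticMaps Y Z F → ∀ f : Y → Y,
          (IsFirstIntegral F f → ∀ y₀ y₁ : Y, RKStep A b f y₀ y₁ → F y₁ = F y₀) ∧
          ∀ (y₀ : Y) (p : Y × Z), RKStep A b (augmentedField F f) (y₀, F y₀) p ↔
            ∃ y₁ : Y, RKStep A b f y₀ y₁ ∧ p = (y₁, F y₁)) ∧
    (∀ a : ButcherTree → ℝ, FunctionallyEquivariant cubicMaps.{u} (bSeries a) →
      IsExactFlow.{u} (a ButcherTree.leaf) (bSeries a)) := by
  refine ⟨bSeries_functionallyEquivariant_affineMaps,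
    fun d a hd => functionallyEquivariant_polynomialMaps_of_preservesInvariants hd,
    fun s A b hAb => ?_, fun a => isExactFlow_of_functionallyEquivariant_cubicMaps⟩
  have hinv := hAb.preservesInvariants_bSeries
  exact ⟨hinv, functionallyEquivariant_polynomialMaps_of_preservesInvariants one_le_two hinv,
    fun Y Z _ _ _ _ F hF f => ⟨fun hf _ _ => hAb.rkStep_apply_eq hF hf,
      hAb.rkStep_augmentedField_iff hF f⟩⟩

theorem mainTheorem3 :
    -- (a)
    (∀ a : ButcherTree → ℝ, FunctionallyEquivariant affineMaps.{u} (bSeries a)) ∧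
    -- (b)
    (∀ a : ButcherTree → ℝ, PreservesInvariants quadraticMaps.{u} (bSeries a) →
      FunctionallyEquivariant quadraticMaps.{u} (bSeries a)) ∧
    -- the example in (b): Gauss–Legendre methods as B-series, then as maps (Runge–Kutta steps)
    (∀ (s : ℕ) (c : Fin s → ℝ), IsGaussNodes c →
      PreservesInvariants quadraticMaps.{u}
        (bSeries (rkWeight (collocationMatrix c) (collocationWeights c))) ∧
      FunctionallyEquivariant quadraticMaps.{u}
        (bSeries (rkWeight (collocationMatrix c) (collocationWeights c))) ∧
      ∀ (Y Z : Type u) [NormedAddCommGroup Y] [NormedSpace ℝ Y] [CompleteSpace Y]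
        [NormedAddCommGroup Z] [NormedSpace ℝ Z] [CompleteSpace Z] (F : Y → Z),
        quadraticMaps Y Z F → ∀ f : Y → Y, ContDiff ℝ ∞ f →
          (IsFirstIntegral F f → ∀ y₀ y₁ : Y,
            RKStep (collocationMatrix c) (collocationWeights c) f y₀ y₁ → F y₁ = F y₀) ∧
          ∀ (y₀ : Y) (p : Y × Z),
            RKStep (collocationMatrix c) (collocationWeights c) (augmentedField F f)
                (y₀, F y₀) p ↔
              ∃ y₁ : Y, RKStep (collocationMatrix c) (collocationWeights c) f y₀ y₁ ∧
                p = (y₁, F y₁)) ∧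
    -- (c)
    (∀ a : ButcherTree → ℝ, (∀ r : ℝ, ¬ IsExactFlow.{u} r (bSeries a)) →
      ¬ FunctionallyEquivariant cubicMaps.{u} (bSeries a)) := by
  obtain ⟨affine, polynomial, symplectic, cubic⟩ := mainTheorem3_general.{u}
  refine ⟨affine, fun a => polynomial 2 a one_le_two, fun s c hc => ?_,
    fun a ha h => ha _ (cubic a h)⟩
  obtain ⟨hinv, hequivariant, hstep⟩ := symplectic s _ _ hc.isSymplecticTableau
  exact ⟨hinv, hequivariant, fun Y Z _ _ _ _ _ _ F hF f _ => hstep Y Z F hF f⟩
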